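/- Let $m\ge 1$ and $1\le u\le v\le n-1$ be integers. Let $\varepsilon_1,\dots,\varepsilon_n$ be the standard basis of $\mathbb R^n$, $V=\{a\in\mathbb R^n:\sum_i a_i=0\}$, $\alpha_{ij}=\varepsilon_i-\varepsilon_{j+1}$ for $1\le i\le j\le n-1$, and $H_{\alpha,k}=\{x\in V:\langle x,\alpha\rangle=k\}$. The $m$-Shi arrangement is $\{H_{\alpha_{ij},k}: 1\le i\le j\le n-1,\ -m<k\le m\}$; its regions are the connected components of the complement in $V$ of the union of these hyperplanes, and a region is dominant if it is contained in $\{x\in V:\langle x,\alpha_{ii}\rangle\ge 0 \text{ for } 1\le i\le n-1\}$. Let $\mathcal A_0$ be the interior of the set of $x$ with $\langle x,\alpha_{ii}\rangle\ge 0$ for all $i$ and $\langle x,\alpha_{1,n-1}\rangle\le 1$. A wall of a region $R$ is a hyperplane of the arrangement that supports a facet of $R$. A hyperplane $H$ separates $R$ from $\mathcal A_0$ if $R$ and $\mathcal A_0$ lie in different closed half-spaces of $H$, and a separating wall of $R$ is a wall of $R$ that separates $R$ from $\mathcal A_0$. For a dominant region $R$ put $$r(R)=|\{(j,k): 1\le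 j\le n-1,\ 1\le k\le m,\ H_{\alpha_{1j},k}\text{ separates } R \text{ from }\mathcal A_0\}|,$$ $$c(R)=|\{(i,k): 1\le i\le n-1,\ 1\le k\le m,\ H_{\alpha_{i,n-1},k}\text{ separates } R \text{ from }\mathcal A_0\}|,$$ and let $$F^n_{\alpha_{uv},m}(p,q)=\sum_{R} p^{c(R)}q^{r(R)},$$ where $R$ runs over the set of dominant regions of the $m$-Shi arrangement that have $H_{\alpha_{uv},m}$ as a separating wall. Put $[k]_{p,q}=\sum_{j=0}^{k-1}p^jq^{k-1-j}$ and $[k]_p=[k]_{1,p}$. For $f\in\mathbb Z[p,q]$ let $(f)_{\le_p N}$ be the sum of the terms of $f$ whose degree in $p$ is at most $N$, and define $$\phi_{k,m}(f)=\left(q^m\,[m(k-2)+1]_p\,f\right)_{\le_p (k-1)m},\qquad \rho(f)(p,q)=f(q,p).$$ Then the set of dominant regions having $H_{\alpha_{uv},m}$ as a separating wall is finite, and $$F^n_{\alpha_{uv},m}(p,q)=\phi_{n,m}\bigl(\phi_{n-1,m}(\cdots\phi_{v+2,m}(\rho(\phi_{v+1,m}(\cdots\phi_{v-u+3,m}(p^mq^m[m]_{p,q}^{v-u})\cdots)))\cdots)\bigr),$$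 where the operators outside $\rho$ are $\phi_{k,m}$ for $k=v+2,\dots,n$ (none if $v=n-1$), those inside are $\phi_{k,m}$ for $k=v-u+3,\dots,v+1$ (none if $u=1$), and in each group smaller indices are applied first. In particular, the number of dominant regions with separating wall $H_{\alpha_{uv},m}$ is the value of the right-hand side at $p=q=1$. -/

import Mathlib

open MvPolynomial

noncomputable section

namespace ShiArr

/-! ### Roots, hyperplanes and the extended Shi arrangement of type `A_{n-1}` -/

/-- The space `V = {(a_1, …, a_n) ∈ ℝⁿ | ∑ a_i = 0}`, with the Euclidean inner product. -/
def V (n : ℕ) : Submodule ℝ (EuclideanSpace ℝ (Fin n)) where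
  carrier := {a | ∑ i, a i = 0}
  zero_mem' := by simp
  add_mem' := by
    intro a b ha hb
    simp only [Set.mem_ofPred_eq] at ha hb ⊢
    simp [Finset.sum_add_distrib, ha, hb]
  smul_mem' := by
    intro c a ha
    simp only [Set.mem_ofPred_eq] at ha ⊢
    simp [← Finset.mul_sum, ha]

/-- The standard basis vector `ε_i` of `ℝⁿ`, with `i` counted from `1` to `n`. -/
def eps (n i : ℕ) : EuclideanSpace ℝ (Fin n) :=
  WithLp.toLp 2 (fun k : Fin n => if (k : ℕ) + 1 = i then 1 else 0)

/-- The positive root `α_{ij} = α_i + ⋯ + α_j = ε_i - ε_{j+1}`, for `1 ≤ i ≤ j ≤ n - 1`. -/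
def root (n i j : ℕ) : EuclideanSpace ℝ (Fin n) := eps n i - eps n (j + 1)

/-- The positive roots `ε_i - ε_j` with `1 ≤ i < j ≤ n`. -/
def posRoots (n : ℕ) : Set (EuclideanSpace ℝ (Fin n)) :=
  {α | ∃ i j : ℕ, 1 ≤ i ∧ i < j ∧ j ≤ n ∧ α = eps n i - eps n j}

/-- The hyperplane `H_{α,k} = {x ∈ V | ⟨x, α⟩ = k}`. -/
def hyp {n : ℕ} (α : EuclideanSpace ℝ (Fin n)) (k : ℤ) : Set (V n) :=
  {x | inner ℝ (x : EuclideanSpace ℝ (Fin n)) α = (k : ℝ)}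

/-- The closed half-space `⟨x, α⟩ ≥ k`. -/
def halfPos {n : ℕ} (α : EuclideanSpace ℝ (Fin n)) (k : ℤ) : Set (V n) :=
  {x | (k : ℝ) ≤ inner ℝ (x : EuclideanSpace ℝ (Fin n)) α}

/-- The closed half-space `⟨x, α⟩ ≤ k`. -/
def halfNeg {n : ℕ} (α : EuclideanSpace ℝ (Fin n)) (k : ℤ) : Set (V n) :=
  {x | inner ℝ (x : EuclideanSpace ℝ (Fin n)) α ≤ (k : ℝ)}

/-- The `m`-Shi arrangement `{H_{α,k} | α > 0, -m < k ≤ m}`. -/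
def arrangement (n m : ℕ) : Set (Set (V n)) :=
  {H | ∃ α ∈ posRoots n, ∃ k : ℤ, -(m : ℤ) < k ∧ k ≤ (m : ℤ) ∧ H = hyp α k}

/-- The complement of the union of the hyperplanes of the `m`-Shi arrangement. -/
def complementSet (n m : ℕ) : Set (V n) := (⋃₀ arrangement n m)ᶜ

/-- The regions: connected components of the complement of the arrangement. -/
def regions (n m : ℕ) : Set (Set (V n)) :=
  {R | ∃ x ∈ complementSet n m, R = connectedComponentIn (complementSet n m) x}

/-- The dominant chamber `⟨x, α_i⟩ ≥ 0` for `1 ≤ i ≤ n - 1`. -/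
def dominantChamber (n : ℕ) : Set (V n) :=
  {x | ∀ i : ℕ, 1 ≤ i → i ≤ n - 1 → x ∈ halfPos (root n i i) 0}

/-- The dominant regions of the `m`-Shi arrangement. -/
def dominantRegions (n m : ℕ) : Set (Set (V n)) :=
  {R | R ∈ regions n m ∧ R ⊆ dominantChamber n}

/-- The fundamental alcove, where `θ = α_{1,n-1}` is the highest root. -/
def fundamentalAlcove (n : ℕ) : Set (V n) :=
  interior (halfNeg (root n 1 (n - 1)) 1 ∩ dominantChamber n)

/-- `R` and `S` lie in different closed half-spaces of the hyperplane `H_{α,k}`. -/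
def Separated {n : ℕ} (α : EuclideanSpace ℝ (Fin n)) (k : ℤ) (R S : Set (V n)) : Prop :=
  (R ⊆ halfPos α k ∧ S ⊆ halfNeg α k) ∨ (R ⊆ halfNeg α k ∧ S ⊆ halfPos α k)

/-- `H` is a wall of the region `R`: it is a hyperplane of the arrangement and supports a facet
of `R`, that is, the face `closure R ∩ H` has full dimension in `H`. -/
def IsWall (n m : ℕ) (R H : Set (V n)) : Prop :=
  H ∈ arrangement n m ∧ (affineSpan ℝ (closure R ∩ H) : Set (V n)) = H

/-- `H_{α,k}` is a wall of `R` that separates `R` from the fundamental alcove. -/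
def IsSeparatingWall (n m : ℕ) (R : Set (V n)) (α : EuclideanSpace ℝ (Fin n)) (k : ℤ) : Prop :=
  IsWall n m R (hyp α k) ∧ Separated α k R (fundamentalAlcove n)

/-- The dominant regions of the `m`-Shi arrangement that have `H_{α,k}` as a separating wall. -/
def sepSet (n m : ℕ) (α : EuclideanSpace ℝ (Fin n)) (k : ℤ) : Set (Set (V n)) :=
  {R | R ∈ dominantRegions n m ∧ IsSeparatingWall n m R α k}

/-! ### The statistics and the generating function -/

/-- The number of pairs `(j, k)` with `1 ≤ j ≤ n - 1`, `1 ≤ k ≤ m` such that `H_{α_{1j},k}`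
separates `R` from the fundamental alcove. -/
def rStat (n m : ℕ) (R : Set (V n)) : ℕ :=
  Set.ncard {jk : ℕ × ℕ | 1 ≤ jk.1 ∧ jk.1 ≤ n - 1 ∧ 1 ≤ jk.2 ∧ jk.2 ≤ m ∧
    Separated (root n 1 jk.1) (jk.2 : ℤ) R (fundamentalAlcove n)}

/-- The number of pairs `(i, k)` with `1 ≤ i ≤ n - 1`, `1 ≤ k ≤ m` such that `H_{α_{i,n-1},k}`
separates `R` from the fundamental alcove. -/
def cStat (n m : ℕ) (R : Set (V n)) : ℕ :=
  Set.ncard {ik : ℕ × ℕ | 1 ≤ ik.1 ∧ ik.1 ≤ n - 1 ∧ 1 ≤ ik.2 ∧ ik.2 ≤ m ∧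
    Separated (root n ik.1 (n - 1)) (ik.2 : ℤ) R (fundamentalAlcove n)}

/-- Polynomials in the two variables `p` and `q`. -/
abbrev Poly : Type := MvPolynomial (Fin 2) ℤ

/-- The variable `p`. -/
def p : Poly := X 0

/-- The variable `q`. -/
def q : Poly := X 1

/-- The generating function `F^n_{α,m}(p,q) = ∑_R p^{c(R)} q^{r(R)}`, summed over the dominant
regions `R` having `H_{α,m}` as a separating wall. -/
def genFun (n m : ℕ) (α : EuclideanSpace ℝ (Fin n)) : Poly :=
  ∑ᶠ R ∈ sepSet n m α (m : ℤ), p ^ cStat n m R * q ^ rStat n m R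

/-- `[k]_{a,b} = ∑_{j=0}^{k-1} a^j b^{k-1-j}`. -/
def polyInt (k : ℕ) (a b : Poly) : Poly := ∑ j ∈ Finset.range k, a ^ j * b ^ (k - 1 - j)

/-- Truncation in the variable `p`: keep exactly the terms of `p`-degree at most `N`. -/
def truncP (N : ℕ) (f : Poly) : Poly :=
  ∑ d ∈ f.support with d 0 ≤ N, monomial d (coeff d f)

/-- The operator `φ_{k,m}(f) = (q^m [m(k-2)+1]_p f)_{≤_p (k-1)m}`, for `k ≥ 2`;
here `[N]_p = [N]_{1,p}`. -/
def phi (k m : ℕ) (f : Poly) : Poly :=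
  truncP ((k - 1) * m) (q ^ m * polyInt (m * (k - 2) + 1) 1 p * f)

/-- The composite `φ_{b,m} ∘ φ_{b-1,m} ∘ ⋯ ∘ φ_{a,m}`, the operator with index `a` being applied
first; it is the identity if `b < a`. -/
def phiRange (m a b : ℕ) (f : Poly) : Poly :=
  (List.Ico a (b + 1)).foldl (fun g k => phi k m g) f

/-- The swap `ρ(f)(p,q) = f(q,p)`. -/
def rho (f : Poly) : Poly := rename (Equiv.swap (0 : Fin 2) 1) f

/-- The right-hand side of the full recursion:
`φ_{n,m}(⋯ φ_{v+2,m}(ρ(φ_{v+1,m}(⋯ φ_{v-u+3,m}(p^m q^m [m]_{p,q}^{v-u}) ⋯))) ⋯)`. -/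
def recursionRHS (n m u v : ℕ) : Poly :=
  phiRange m (v + 2) n
    (rho (phiRange m (v - u + 3) (v + 1) (p ^ m * q ^ m * polyInt m p q ^ (v - u))))

end ShiArr

end

/-! A dominant region is encoded by its Shi tableau. For coordinates `y 0 > … > y (n - 1)` the entry
`(i, j)` is the integer part of `y i - y j` capped at `m`: the number of `k` in `1, …, m` whose
hyperplane in that direction separates the region from the alcove. So `c` and `r` are the sums of
the last column and of the first row. In 0-based indices the wall sits at the entry `(u - 1, v)`. It
is a separating wall exactly when that entry is `m` and any two entries adding up to it have sum `m
- 1`. In that case lowering the entry to `m - 1` preserves Shi's inequalities, so there is a region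
across the hyperplane (`exists_generic_neighbour`, `isWall_cell`); otherwise the face lies in a
second hyperplane (`sepCond_of_isWall`). Hence `bijOn_cell` reduces the theorem to counting
tableaux.

Three facts count them. Appending a last point: the thresholds `y i - k` are ordered by the old
tableau, and the new column records which of them lie above the new point. So the column is
determined by its sum, which takes each value from the old column sum to `n * m`, while the first
row gains `m`; this is `phi` (`tabGenFun_succ`). Reversing the points exchanges row and column; this
is `rho` (`tabGenFun_eq_rho`). When the wall belongs to the first and last points, a tableau amounts
to the integer parts and the order of the fractional parts of the `N` points between, that is, to an
arbitrary function `Fin N → Fin m` (`tabGenFun_zero`). The formula follows by deleting the points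
after the wall, reversing, and deleting again. -/

namespace ShiArr

/-! ### Shi tableaux of generic points -/

/-- The points `y 0, …, y (n - 1)` are strictly decreasing, and no difference of two of them is
one of the integers `0, …, m`. -/
def Generic (n m : ℕ) (y : ℕ → ℝ) : Prop :=
  ∀ i j, i < j → j < n → 0 < y i - y j ∧ ∀ k : ℕ, k ≤ m → y i - y j ≠ k

/-- The Shi tableau of the points `y 0, …, y (n - 1)`. -/
noncomputable def tab (n m : ℕ) (y : ℕ → ℝ) (i j : ℕ) : ℕ :=
  if i < j ∧ j < n then min m ⌊y i - y j⌋₊ else 0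

/-- The sum of the last column of a tableau. -/
def colSum (n : ℕ) (E : ℕ → ℕ → ℕ) : ℕ := ∑ i ∈ Finset.range (n - 1), E i (n - 1)

/-- The sum of the first row of a tableau. -/
def rowSum (n : ℕ) (E : ℕ → ℕ → ℕ) : ℕ := ∑ j ∈ Finset.range (n - 1), E 0 (j + 1)

/-- The entry `(u, w)` of the tableau is `m`, and any two entries adding up to it combinatorially
have sum `m - 1`. -/
def SepCond (m u w : ℕ) (E : ℕ → ℕ → ℕ) : Prop :=
  E u w = m ∧ ∀ t, u < t → t < w → E u t + E t w + 1 = m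

/-- The tableaux of generic points that satisfy the separating wall condition at `(u, w)`. -/
def sepTab (n m u w : ℕ) : Set (ℕ → ℕ → ℕ) :=
  {E | (∃ y, Generic n m y ∧ E = tab n m y) ∧ SepCond m u w E}

theorem tab_le (n m : ℕ) (y : ℕ → ℝ) (i j : ℕ) : tab n m y i j ≤ m := by
  unfold tab; split_ifs <;> simp

theorem tab_of_not {n m : ℕ} {y : ℕ → ℝ} {i j : ℕ} (h : ¬ (i < j ∧ j < n)) :
    tab n m y i j = 0 := if_neg h

theorem Generic.pos {n m : ℕ} {y : ℕ → ℝ} (hy : Generic n m y) {i j : ℕ} (hij : i < j)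
    (hj : j < n) : 0 < y i - y j := (hy i j hij hj).1

/-- The dictionary between entries and sides of hyperplanes; genericity turns the weak inequality of
the floor into a strict one. -/
theorem Generic.le_tab_iff {n m : ℕ} {y : ℕ → ℝ} (hy : Generic n m y) {i j k : ℕ} (hij : i < j)
    (hj : j < n) (hk : k ≤ m) : k ≤ tab n m y i j ↔ (k : ℝ) < y i - y j := by
  have h := hy i j hij hj
  rw [tab, if_pos ⟨hij, hj⟩, le_min_iff, Nat.le_floor_iff h.1.le]
  exact ⟨fun h' => lt_of_le_of_ne h'.2 (h.2 k hk).symm, fun h' => ⟨hk, h'.le⟩⟩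

theorem Generic.tab_lt_iff {n m : ℕ} {y : ℕ → ℝ} (hy : Generic n m y) {i j k : ℕ} (hij : i < j)
    (hj : j < n) (hk : k ≤ m) : tab n m y i j < k ↔ y i - y j < k := by
  rw [← not_le, hy.le_tab_iff hij hj hk, not_lt]
  exact ⟨fun h' => lt_of_le_of_ne h' ((hy i j hij hj).2 k hk), le_of_lt⟩

theorem Generic.tab_lt {n m : ℕ} {y : ℕ → ℝ} (hy : Generic n m y) {i j : ℕ} (hij : i < j)
    (hj : j < n) : (tab n m y i j : ℝ) < y i - y j :=
  (hy.le_tab_iff hij hj (tab_le ..)).1 le_rfl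

theorem Generic.lt_tab_add_one {n m : ℕ} {y : ℕ → ℝ} (hy : Generic n m y) {i j : ℕ} (hij : i < j)
    (hj : j < n) (h : tab n m y i j < m) : y i - y j < tab n m y i j + 1 := by
  have := (hy.tab_lt_iff hij hj (k := tab n m y i j + 1) h).1 (Nat.lt_succ_self _)
  exact_mod_cast this

theorem Generic.tab_eq_iff {n m : ℕ} {y y' : ℕ → ℝ} (hy : Generic n m y) (hy' : Generic n m y') :
    tab n m y = tab n m y' ↔
      ∀ i j k : ℕ, i < j → j < n → k ≤ m → ((k : ℝ) < y i - y j ↔ (k : ℝ) < y' i - y' j) := by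
  constructor
  · intro h i j k hij hj hk
    rw [← hy.le_tab_iff hij hj hk, h, hy'.le_tab_iff hij hj hk]
  · intro h
    funext i j
    by_cases hc : i < j ∧ j < n
    · apply le_antisymm
      · rw [hy'.le_tab_iff hc.1 hc.2 (tab_le ..), ← h i j _ hc.1 hc.2 (tab_le ..)]
        exact hy.tab_lt hc.1 hc.2
      · rw [hy.le_tab_iff hc.1 hc.2 (tab_le ..), h i j _ hc.1 hc.2 (tab_le ..)]
        exact hy'.tab_lt hc.1 hc.2
    · rw [tab_of_not hc, tab_of_not hc]

theorem Generic.mono {n n' m : ℕ} {y : ℕ → ℝ} (hy : Generic n m y) (h : n' ≤ n) :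
    Generic n' m y := fun i j hij hj => hy i j hij (hj.trans_le h)

theorem Generic.tab_mono {n m : ℕ} {y : ℕ → ℝ} (hy : Generic n m y) {a b c d : ℕ} (hac : a ≤ b)
    (hcd : c ≤ d) (hbc : b < c) (hd : d < n) : tab n m y b c ≤ tab n m y a d := by
  have h1 : ∀ i j, i ≤ j → j < n → y j ≤ y i := by
    intro i j hij hj
    rcases hij.eq_or_lt with rfl | h
    · rfl
    · linarith [hy.pos h hj]
  rw [hy.le_tab_iff (by omega) hd (tab_le ..)]
  have := hy.tab_lt hbc (hcd.trans_lt hd)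
  have h2 := h1 a b hac (by omega)
  have h3 := h1 c d hcd hd
  linarith

theorem finite_setOf_tab (n m : ℕ) : {E | ∃ y, E = tab n m y}.Finite := by
  have hs : ((Set.univ : Set (Fin n → Fin n → Fin (m + 1))).image
      (fun g i j => if h : i < n ∧ j < n then (g ⟨i, h.1⟩ ⟨j, h.2⟩ : ℕ) else 0)).Finite :=
    Set.toFinite _
  refine hs.subset ?_
  rintro E ⟨y, rfl⟩
  refine ⟨fun i j => ⟨tab n m y i j, Nat.lt_succ_of_le (tab_le ..)⟩, trivial, ?_⟩
  funext i j
  by_cases h : i < n ∧ j < n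
  · simp [h]
  · simp only [h, dite_false]
    rw [tab_of_not (by omega)]

theorem finite_sepTab (n m u w : ℕ) : (sepTab n m u w).Finite :=
  (finite_setOf_tab n m).subset fun _ ⟨⟨y, _, h⟩, _⟩ => ⟨y, h⟩

/-- The generating function of the tableaux in `sepTab n m u w` by their last column and first row
sums. -/
noncomputable def tabGenFun (n m u w : ℕ) : Poly :=
  ∑ E ∈ (finite_sepTab n m u w).toFinset, p ^ colSum n E * q ^ rowSum n E

/-! ### Adding a last point -/

theorem exists_lt_forall_notMem {ι : Type*} (s : Finset ι) (f : ι → ℝ) (a : ℝ) :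
    ∃ t < a, ∀ i ∈ s, f i < a → f i < t := by
  have h : ∀ᶠ t in nhdsWithin a (Set.Iio a), ∀ i ∈ s, f i < a → f i < t := by
    rw [Filter.eventually_all_finset]
    intro i _
    by_cases hi : f i < a
    · filter_upwards [Ioo_mem_nhdsLT hi] with t ht _ using ht.1
    · simp [hi]
  have h₀ : ∀ᶠ t in nhdsWithin a (Set.Iio a), t < a := self_mem_nhdsWithin
  obtain ⟨t, ht, h2⟩ := (h₀.and h).exists
  exact ⟨t, ht, h2⟩

/-- As `t` slides down from `t₀` it passes the values of `f` one at a time, by injectivity, so the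
count of values above `t` skips no number. -/
theorem exists_card_filter_lt_eq {ι : Type*} (s : Finset ι) (f : ι → ℝ) (hf : Set.InjOn f s)
    (t₀ : ℝ) (c : ℕ) (h₀ : (s.filter fun i => t₀ ≤ f i).card ≤ c) (hc : c ≤ s.card) :
    ∃ t < t₀, (∀ i ∈ s, f i ≠ t) ∧ (s.filter fun i => t < f i).card = c := by
  induction c, h₀ using Nat.le_induction with
  | base =>
    obtain ⟨t, ht, h⟩ := exists_lt_forall_notMem s f t₀
    refine ⟨t, ht, ?_, ?_⟩
    · rintro i hi rfl
      exact lt_irrefl _ (h i hi ht)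
    · congr 1
      refine Finset.filter_congr fun i hi => ⟨fun h' => ?_, fun h' => ht.trans_le h'⟩
      by_contra h2
      exact lt_asymm h' (h i hi (not_le.1 h2))
  | succ c _ ih =>
    obtain ⟨t, ht, hne, hcard⟩ := ih (by omega)
    have hex : (s.filter fun i => f i < t).Nonempty := by
      by_contra hemp
      rw [Finset.not_nonempty_iff_eq_empty, Finset.filter_eq_empty_iff] at hemp
      have : s.filter (fun i => t < f i) = s :=
        Finset.filter_true_of_mem fun i hi =>
          lt_of_le_of_ne (not_lt.1 (hemp hi)) (hne i hi).symm
      rw [this] at hcard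
      omega
    -- The next value to be passed is the largest one below `t`; the new `t'` is chosen just below
    -- it.
    obtain ⟨a, ha, hmax⟩ := Finset.exists_max_image _ f hex
    rw [Finset.mem_filter] at ha
    obtain ⟨t', ht', h'⟩ := exists_lt_forall_notMem s f (f a)
    refine ⟨t', by linarith [ha.2], ?_, ?_⟩
    · rintro i hi rfl
      exact lt_irrefl _ (h' i hi ht')
    · classical
      have : s.filter (fun i => t' < f i) = insert a (s.filter fun i => t < f i) := by
        ext i
        simp only [Finset.mem_filter, Finset.mem_insert]
        constructor
        · rintro ⟨hi, h1⟩
          rcases lt_trichotomy (f i) (f a) with h2 | h2 | h2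
          · exact absurd (h' i hi h2) (not_lt.2 h1.le)
          · exact Or.inl (hf hi ha.1 h2)
          · refine Or.inr ⟨hi, ?_⟩
            by_contra h3
            have h4 := lt_of_le_of_ne (not_lt.1 h3) (hne i hi)
            have := hmax i (by simp [hi, h4])
            linarith
        · rintro (rfl | ⟨hi, h1⟩)
          · exact ⟨ha.1, ht'⟩
          · exact ⟨hi, by linarith [ha.2]⟩
      rw [this, Finset.card_insert_of_notMem, hcard]
      simp [ha.2.le]

theorem tab_congr {n m : ℕ} {y y' : ℕ → ℝ} (h : ∀ i < n, y i = y' i) :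
    tab n m y = tab n m y' := by
  funext i j
  unfold tab
  split_ifs with hc
  · rw [h i (by omega), h j hc.2]
  · rfl

/-- An entry in column `j` counts the `k` in `1, …, m` with threshold `y i - k` above `y j`, so a
partial column sum counts thresholds. -/
theorem Generic.sum_tab {n m : ℕ} {y : ℕ → ℝ} (hy : Generic n m y) (s : Finset ℕ) {j : ℕ}
    (hs : ∀ i ∈ s, i < j) (hj : j < n) : ∑ i ∈ s, tab n m y i j =
      ((s ×ˢ Finset.Icc 1 m).filter fun ik => y j < y ik.1 - ik.2).card := by
  rw [Finset.card_filter, Finset.sum_product]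
  refine Finset.sum_congr rfl fun i hi => ?_
  rw [← Finset.card_filter]
  have : (Finset.Icc 1 m).filter (fun k : ℕ => y j < y i - k) = Finset.Icc 1 (tab n m y i j) := by
    ext k
    simp only [Finset.mem_filter, Finset.mem_Icc]
    constructor
    · rintro ⟨⟨h1, h2⟩, h3⟩
      exact ⟨h1, (hy.le_tab_iff (hs i hi) hj h2).2 (by linarith)⟩
    · rintro ⟨h1, h2⟩
      have h3 := h2.trans (tab_le n m y i j)
      have := (hy.le_tab_iff (hs i hi) hj h3).1 h2
      exact ⟨⟨h1, h3⟩, by linarith⟩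
  simp [this]

/-- Two equal thresholds with different indices would make a difference of points nonpositive or an
integer at most `m`. -/
theorem Generic.injOn_sub {n m : ℕ} {y : ℕ → ℝ} (hy : Generic n m y) :
    Set.InjOn (fun ik : ℕ × ℕ => y ik.1 - ik.2)
      ((Finset.range n ×ˢ Finset.Icc 1 m : Finset (ℕ × ℕ)) : Set (ℕ × ℕ)) := by
  have key : ∀ i j k l : ℕ, i < j → j < n → 1 ≤ l → k ≤ m → y i - k ≠ y j - l := by
    intro i j k l hij hj hl hk h
    have h0 := hy i j hij hj
    rcases le_or_gt k l with hkl | hkl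
    · have : (k : ℝ) ≤ l := by exact_mod_cast hkl
      linarith [h0.1]
    · refine h0.2 (k - l) (by omega) ?_
      rw [Nat.cast_sub hkl.le]
      linarith
  rintro ⟨i, k⟩ h1 ⟨j, l⟩ h2 h
  simp only [Finset.coe_product, Set.mem_prod, Finset.mem_coe, Finset.mem_range,
    Finset.mem_Icc] at h1 h2 h
  rcases lt_trichotomy i j with hij | rfl | hij
  · exact absurd h (key i j k l hij h2.1 h2.2.1 h1.2.2)
  · simp only [sub_right_inj, Nat.cast_inj] at h
    rw [h]
  · exact absurd h.symm (key j i l k hij h1.1 h1.2.1 h2.2.2)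

/-- The new point `t` is placed below `y (n - 1)`, and its column sum is the number of thresholds
above `t`. This starts at the old column sum when `t` is just below `y (n - 1)` (the thresholds of
`y (n - 1)` itself are lower) and grows by single steps to `n * m`. -/
theorem exists_extension {n m : ℕ} (hn : 1 ≤ n) {y : ℕ → ℝ} (hy : Generic n m y) {c : ℕ}
    (h₀ : colSum n (tab n m y) ≤ c) (hc : c ≤ n * m) :
    ∃ y', Generic (n + 1) m y' ∧ tab n m y' = tab n m y ∧
      colSum (n + 1) (tab (n + 1) m y') = c := by
  obtain ⟨t, ht, hne, hcard⟩ := exists_card_filter_lt_eq (Finset.range n ×ˢ Finset.Icc 1 m)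
    (fun ik => y ik.1 - ik.2) hy.injOn_sub (y (n - 1)) c (by
      refine le_trans (le_of_eq ?_) h₀
      rw [colSum, hy.sum_tab _ (by simp) (by omega)]
      congr 1
      ext ⟨i, k⟩
      simp only [Finset.mem_filter, Finset.mem_product, Finset.mem_range, Finset.mem_Icc]
      constructor
      · rintro ⟨⟨h1, h2⟩, h3⟩
        have hk : (1 : ℝ) ≤ k := by exact_mod_cast h2.1
        rcases Nat.lt_or_ge i (n - 1) with hi | hi
        · refine ⟨⟨hi, h2⟩, lt_of_le_of_ne h3 fun h => ?_⟩
          exact (hy i (n - 1) hi (by omega)).2 k h2.2 (by linarith)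
        · obtain rfl : i = n - 1 := by omega
          linarith
      · rintro ⟨⟨h1, h2⟩, h3⟩
        exact ⟨⟨by omega, h2⟩, h3.le⟩) (by simpa using hc)
  have hy' : Generic (n + 1) m (Function.update y n t) := by
    intro i j hij hj
    rcases Nat.lt_or_ge j n with hjn | hjn
    · rw [Function.update_of_ne (by omega), Function.update_of_ne (by omega)]
      exact hy i j hij hjn
    · obtain rfl : j = n := by omega
      rw [Function.update_self, Function.update_of_ne (by omega)]
      have hle : y (j - 1) ≤ y i := by
        rcases (show i ≤ j - 1 by omega).eq_or_lt with rfl | h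
        · rfl
        · linarith [hy.pos h (by omega)]
      refine ⟨by linarith, fun k hk h => ?_⟩
      rcases Nat.eq_zero_or_pos k with rfl | hk0
      · simp only [Nat.cast_zero] at h
        linarith
      · exact hne (i, k) (by simp; omega) (by simp only; linarith)
  refine ⟨_, hy', tab_congr fun i hi => Function.update_of_ne hi.ne _ _, ?_⟩
  rw [colSum, Nat.add_sub_cancel, hy'.sum_tab _ (by simp) (by omega), ← hcard]
  congr 1
  refine Finset.filter_congr fun ik hik => ?_
  simp only [Finset.mem_product, Finset.mem_range] at hik
  rw [Function.update_self, Function.update_of_ne (by omega)]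

/-- The tableau fixes the order of the thresholds: `y i - k` below `y j - l` for one configuration
cannot be above it for another with the same tableau. -/
theorem Generic.tab_sep {n m : ℕ} {y₁ y₂ : ℕ → ℝ} (h₁ : Generic n m y₁) (h₂ : Generic n m y₂)
    (h : tab n m y₁ = tab n m y₂) {i j k l : ℕ} (hi : i < n) (hj : j < n) (hk : 1 ≤ k)
    (hkm : k ≤ m) (hl : 1 ≤ l) (hlm : l ≤ m) (hlt : y₁ i - y₁ j < k - l) :
    y₂ i - y₂ j ≤ k - l := by
  rw [h₁.tab_eq_iff h₂] at h
  rcases lt_trichotomy i j with hij | rfl | hij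
  · have hkl : l < k := by
      have := h₁.pos hij hj
      have : (l : ℝ) < k := by linarith
      exact_mod_cast this
    have h' := h i j (k - l) hij hj (by omega)
    rw [Nat.cast_sub hkl.le] at h'
    by_contra hcon
    have := h'.2 (not_le.1 hcon)
    linarith
  · linarith [sub_self (y₁ i), sub_self (y₂ i)]
  · rcases Nat.lt_or_ge l k with hkl | hkl
    · have := h₂.pos hij hi
      have : (l : ℝ) < k := by exact_mod_cast hkl
      linarith
    · have h' := h j i (l - k) hij hi (by omega)
      rw [Nat.cast_sub hkl] at h'
      have := h'.1 (by linarith)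
      linarith

/-- The thresholds above the last point form an upper set in an order fixed by the smaller tableau,
so their number determines them. -/
theorem tab_eq_of_colSum_eq {n m : ℕ} {y₁ y₂ : ℕ → ℝ} (h₁ : Generic (n + 1) m y₁)
    (h₂ : Generic (n + 1) m y₂) (h : tab n m y₁ = tab n m y₂)
    (hc : colSum (n + 1) (tab (n + 1) m y₁) = colSum (n + 1) (tab (n + 1) m y₂)) :
    tab (n + 1) m y₁ = tab (n + 1) m y₂ := by
  have key : ∀ i < n, tab (n + 1) m y₁ i n = tab (n + 1) m y₂ i n := by
    simp only [colSum, Nat.add_sub_cancel] at hc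
    by_contra! hcon
    obtain ⟨a, ha, hne⟩ := hcon
    have e1 : ∃ i < n, tab (n + 1) m y₁ i n < tab (n + 1) m y₂ i n := by
      by_contra! h'
      exact hne ((Finset.sum_eq_sum_iff_of_le fun i hi => h' i (Finset.mem_range.1 hi)).1 hc.symm
        a (Finset.mem_range.2 ha)).symm
    have e2 : ∃ i < n, tab (n + 1) m y₂ i n < tab (n + 1) m y₁ i n := by
      by_contra! h'
      exact hne ((Finset.sum_eq_sum_iff_of_le fun i hi => h' i (Finset.mem_range.1 hi)).1 hc
        a (Finset.mem_range.2 ha))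
    obtain ⟨i, hi, hi'⟩ := e1
    obtain ⟨j, hj, hj'⟩ := e2
    have b1 := tab_le (n + 1) m y₁ j n
    have b2 := tab_le (n + 1) m y₂ i n
    have f1 := h₁.lt_tab_add_one hi n.lt_succ_self (by omega)
    have f2 := h₁.tab_lt hj n.lt_succ_self
    have f3 := h₂.tab_lt hi n.lt_succ_self
    have f4 := h₂.lt_tab_add_one hj n.lt_succ_self (by omega)
    have g1 : ((tab (n + 1) m y₁ i n : ℕ) : ℝ) + 1 ≤ tab (n + 1) m y₂ i n := by exact_mod_cast hi'
    have g2 : ((tab (n + 1) m y₂ j n : ℕ) : ℝ) + 1 ≤ tab (n + 1) m y₁ j n := by exact_mod_cast hj'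
    -- For `y₁` the last point separates the threshold `(i, k)` below from `(j, l)` above; for `y₂`
    -- it separates them the other way round.
    have := (h₁.mono n.le_succ).tab_sep (h₂.mono n.le_succ) h hi hj
      (k := tab (n + 1) m y₁ i n + 1) (l := tab (n + 1) m y₁ j n) (by omega) (by omega) (by omega)
      b1 (by push_cast; linarith)
    push_cast at this
    linarith
  funext i j
  by_cases hc : i < j ∧ j < n + 1
  · rcases Nat.lt_or_ge j n with hj | hj
    · have := congrFun (congrFun h i) j
      unfold tab at this ⊢
      rw [if_pos ⟨hc.1, hj⟩, if_pos ⟨hc.1, hj⟩] at this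
      rw [if_pos hc, if_pos hc, this]
    · obtain rfl : j = n := by omega
      exact key i hc.1
  · rw [tab_of_not hc, tab_of_not hc]

/-! ### Truncation -/

theorem coeff_truncP (N : ℕ) (f : Poly) (d : Fin 2 →₀ ℕ) :
    coeff d (truncP N f) = if d 0 ≤ N then coeff d f else 0 := by
  classical
  rw [truncP, coeff_sum]
  simp only [coeff_monomial, Finset.sum_ite_eq', Finset.mem_filter, mem_support_iff]
  split_ifs <;> simp_all

theorem truncP_sum {ι : Type*} (N : ℕ) (s : Finset ι) (f : ι → Poly) :
    truncP N (∑ i ∈ s, f i) = ∑ i ∈ s, truncP N (f i) := by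
  ext d
  simp only [coeff_truncP, coeff_sum]
  split_ifs <;> simp

theorem truncP_pow_mul_pow (N a b : ℕ) :
    truncP N (p ^ a * q ^ b) = if a ≤ N then p ^ a * q ^ b else 0 := by
  classical
  have h : (p ^ a * q ^ b : Poly) = monomial (Finsupp.single 0 a + Finsupp.single 1 b) 1 := by
    simp [p, q, X_pow_eq_monomial, monomial_mul]
  ext d
  rw [coeff_truncP, h, apply_ite (coeff d), coeff_monomial, coeff_zero]
  by_cases hd : Finsupp.single 0 a + Finsupp.single 1 b = d
  · subst hd
    simp
  · simp [hd]

/-- The factor `[m(n-1)+1]_p` raises the `p`-exponent by `0, …, m(n-1)`. Since `m ≤ a`, this reaches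
the truncation bound, so exactly the exponents `a, …, n * m` survive: the possible sums of a new
column. -/
theorem phi_pow_mul_pow {n m : ℕ} (hn : 1 ≤ n) {a b : ℕ} (ha : m ≤ a) (ha' : a ≤ n * m) :
    phi (n + 1) m (p ^ a * q ^ b) =
      ∑ j ∈ Finset.range (n * m - a + 1), p ^ (a + j) * q ^ (b + m) := by
  have h1 : q ^ m * polyInt (m * (n + 1 - 2) + 1) 1 p * (p ^ a * q ^ b) =
      ∑ j ∈ Finset.range (m * (n - 1) + 1), p ^ (a + j) * q ^ (b + m) := by
    rw [polyInt, ← Finset.sum_range_reflect, Finset.mul_sum, Finset.sum_mul,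
      show n + 1 - 2 = n - 1 by omega]
    refine Finset.sum_congr rfl fun j hj => ?_
    rw [Finset.mem_range] at hj
    rw [show m * (n - 1) + 1 - 1 - (m * (n - 1) + 1 - 1 - j) = j by omega]
    ring
  rw [phi, h1, truncP_sum, Nat.add_sub_cancel]
  simp only [truncP_pow_mul_pow]
  rw [← Finset.sum_filter]
  refine Finset.sum_congr ?_ fun _ _ => rfl
  ext j
  have : n * m = m * (n - 1) + m := by
    obtain ⟨k, rfl⟩ : ∃ k, n = k + 1 := ⟨n - 1, by omega⟩
    simp; ring
  simp only [Finset.mem_filter, Finset.mem_range]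
  omega

theorem phi_sum {ι : Type*} (k m : ℕ) (s : Finset ι) (f : ι → Poly) :
    phi k m (∑ i ∈ s, f i) = ∑ i ∈ s, phi k m (f i) := by
  simp only [phi, Finset.mul_sum, truncP_sum]

/-! ### Deleting the last point: the recursion in `n` -/

/-- The restriction of a tableau to the first `n` points. -/
def restrict (n : ℕ) (E : ℕ → ℕ → ℕ) : ℕ → ℕ → ℕ := fun i j => if j < n then E i j else 0

theorem restrict_tab (n m : ℕ) (y : ℕ → ℝ) : restrict n (tab (n + 1) m y) = tab n m y := by
  funext i j
  unfold restrict tab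
  split_ifs <;> first | rfl | omega

theorem sepCond_restrict {n m u w : ℕ} (hw : w < n) (E : ℕ → ℕ → ℕ) :
    SepCond m u w (restrict n E) ↔ SepCond m u w E := by
  unfold SepCond restrict
  rw [if_pos hw]
  refine and_congr_right fun _ => forall_congr' fun t => forall_congr' fun _ =>
    forall_congr' fun ht => ?_
  rw [if_pos (ht.trans hw), if_pos hw]

theorem Generic.colSum_le {n m : ℕ} {y : ℕ → ℝ} (hy : Generic (n + 1) m y) :
    colSum n (tab n m y) ≤ colSum (n + 1) (tab (n + 1) m y) := by
  rcases n.eq_zero_or_pos with rfl | hn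
  · simp [colSum]
  unfold colSum
  rw [Nat.add_sub_cancel]
  refine le_trans (Finset.sum_le_sum (g := fun i => tab (n + 1) m y i n) fun i hi => ?_)
    (Finset.sum_le_sum_of_subset (Finset.range_mono (Nat.sub_le n 1)))
  rw [Finset.mem_range] at hi
  rw [← restrict_tab, restrict, if_pos (by omega)]
  exact hy.tab_mono le_rfl (Nat.sub_le n 1) hi n.lt_succ_self

theorem colSum_tab_le (n m : ℕ) (y : ℕ → ℝ) : colSum n (tab n m y) ≤ (n - 1) * m := by
  unfold colSum
  refine (Finset.sum_le_card_nsmul _ _ m fun i _ => tab_le ..).trans ?_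
  simp

/-- Monotonicity carries the value `m` at `(u, w)` to the first row. This yields the factor `q ^ m`
in `phi` and the bound `m ≤ colSum` needed for `phi_pow_mul_pow`. -/
theorem tab_eq_of_sepCond {n m u w : ℕ} {y : ℕ → ℝ} (hy : Generic n m y) (huw : u < w)
    (h : SepCond m u w (tab n m y)) {j : ℕ} (hwj : w ≤ j) (hj : j < n) :
    tab n m y 0 j = m :=
  le_antisymm (tab_le ..) (h.1.symm.le.trans (hy.tab_mono (Nat.zero_le u) hwj huw hj))

theorem tabGenFun_succ {n m u w : ℕ} (huw : u < w) (hw : w < n) :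
    tabGenFun (n + 1) m u w = phi (n + 1) m (tabGenFun n m u w) := by
  have hn : 1 ≤ n := by omega
  have hle : ∀ E ∈ (finite_sepTab n m u w).toFinset, m ≤ colSum n E ∧ colSum n E ≤ n * m := by
    intro E hE
    obtain ⟨⟨y, hy, rfl⟩, hs⟩ := (Set.Finite.mem_toFinset _).1 hE
    constructor
    · refine (tab_eq_of_sepCond hy huw hs (j := n - 1) (by omega) (by omega)).symm.le.trans ?_
      exact Finset.single_le_sum (f := fun i => tab n m y i (n - 1)) (fun _ _ => Nat.zero_le _)
        (Finset.mem_range.2 (by omega))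
    · exact (colSum_tab_le n m y).trans (Nat.mul_le_mul_right m (Nat.sub_le n 1))
  rw [tabGenFun, tabGenFun, phi_sum]
  rw [Finset.sum_congr rfl fun E hE => phi_pow_mul_pow hn (hle E hE).1 (hle E hE).2,
    Finset.sum_sigma']
  -- A tableau corresponds to its restriction together with the excess of the new column sum over
  -- the old one.
  refine Finset.sum_bij
    (fun E _ => ⟨restrict n E, colSum (n + 1) E - colSum n (restrict n E)⟩) ?_ ?_ ?_ ?_
  · intro E hE
    obtain ⟨⟨y, hy, rfl⟩, hs⟩ := (Set.Finite.mem_toFinset _).1 hE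
    rw [Finset.mem_sigma, Set.Finite.mem_toFinset]
    refine ⟨⟨⟨y, hy.mono n.le_succ, restrict_tab n m y⟩, (sepCond_restrict hw _).2 hs⟩, ?_⟩
    have := colSum_tab_le (n + 1) m y
    rw [Nat.add_sub_cancel] at this
    simp only [restrict_tab, Finset.mem_range]
    omega
  · intro E hE E' hE' h
    obtain ⟨⟨y, hy, rfl⟩, hs⟩ := (Set.Finite.mem_toFinset _).1 hE
    obtain ⟨⟨y', hy', rfl⟩, hs'⟩ := (Set.Finite.mem_toFinset _).1 hE'
    simp only [restrict_tab, Sigma.mk.injEq, heq_eq_eq] at h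
    refine tab_eq_of_colSum_eq hy hy' h.1 ?_
    have h1 := hy.colSum_le
    have h2 := hy'.colSum_le
    have h3 := h.2
    rw [h.1] at h3 h1
    omega
  · rintro ⟨E, c⟩ hE
    rw [Finset.mem_sigma, Set.Finite.mem_toFinset, Finset.mem_range] at hE
    obtain ⟨⟨⟨y, hy, rfl⟩, hs⟩, hc⟩ := hE
    have := colSum_tab_le n m y
    have h2 : (n - 1) * m ≤ n * m := Nat.mul_le_mul_right m (Nat.sub_le n 1)
    simp only at hc
    obtain ⟨y', hy', h, hc'⟩ := exists_extension hn hy (c := colSum n (tab n m y) + c)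
      (Nat.le_add_right _ _) (by omega)
    refine ⟨tab (n + 1) m y', ?_, ?_⟩
    · rw [Set.Finite.mem_toFinset]
      refine ⟨⟨y', hy', rfl⟩, (sepCond_restrict hw _).1 ?_⟩
      rwa [restrict_tab, h]
    · simp only [restrict_tab, h, hc', Nat.add_sub_cancel_left]
  · intro E hE
    obtain ⟨⟨y, hy, rfl⟩, hs⟩ := (Set.Finite.mem_toFinset _).1 hE
    simp only [restrict_tab]
    rw [Nat.add_sub_cancel' hy.colSum_le]
    congr 2
    unfold rowSum
    rw [Nat.add_sub_cancel]
    obtain ⟨k, rfl⟩ : ∃ k, n = k + 1 := ⟨n - 1, by omega⟩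
    rw [Finset.sum_range_succ, tab_eq_of_sepCond hy huw hs (j := k + 1) (by omega)
      (by omega), Nat.add_sub_cancel, ← restrict_tab (k + 1) m y]
    congr 1
    refine Finset.sum_congr rfl fun j hj => ?_
    rw [Finset.mem_range] at hj
    rw [restrict, if_pos (by omega)]

/-! ### The case where the first and the last point are separated -/

theorem cast_lt_add_iff {k d : ℤ} {x : ℝ} (h₁ : -1 < x) (h₂ : x < 1) :
    (k : ℝ) < d + x ↔ k < d ∨ k = d ∧ 0 < x := by
  rcases lt_trichotomy k d with h | rfl | h
  · have : (k : ℝ) + 1 ≤ d := by exact_mod_cast h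
    simp only [h, true_or, iff_true]
    linarith
  · simp
  · have : (d : ℝ) + 1 ≤ k := by exact_mod_cast h
    simp only [h.not_gt, h.ne', false_and, or_false, iff_false, not_lt]
    linarith

theorem Generic.tab_eq {n m : ℕ} {y : ℕ → ℝ} (hy : Generic n m y) {i j k : ℕ} (hij : i < j)
    (hj : j < n) (hk : k < m) (h₁ : (k : ℝ) < y i - y j) (h₂ : y i - y j < k + 1) :
    tab n m y i j = k := by
  have h1 := (hy.le_tab_iff hij hj hk.le).2 h₁
  have h2 := (hy.tab_lt_iff hij hj (k := k + 1) hk).2 (by push_cast; exact h₂)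
  omega

/-- The point `0`, then the points `-z t`, then `-(m + δ)`. -/
noncomputable def chain (N m : ℕ) (δ : ℝ) (z : Fin N → ℝ) (i : ℕ) : ℝ :=
  if i = 0 then 0 else if h : i - 1 < N then -z ⟨i - 1, h⟩ else -(m + δ)

theorem chain_zero (N m : ℕ) (δ : ℝ) (z : Fin N → ℝ) : chain N m δ z 0 = 0 := if_pos rfl

theorem chain_succ {N m : ℕ} (δ : ℝ) (z : Fin N → ℝ) (t : Fin N) :
    chain N m δ z (t + 1) = -z t := by
  simp [chain]

theorem chain_last (N m : ℕ) (δ : ℝ) (z : Fin N → ℝ) : chain N m δ z (N + 1) = -(m + δ) := by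
  simp [chain]

theorem forall_pairs {N : ℕ} {P : ℕ → ℕ → Prop} (h₁ : P 0 (N + 1)) (h₂ : ∀ t : Fin N, P 0 (t + 1))
    (h₃ : ∀ t : Fin N, P (t + 1) (N + 1)) (h₄ : ∀ s t : Fin N, s < t → P (s + 1) (t + 1)) :
    ∀ i j, i < j → j < N + 2 → P i j := by
  intro i j hij hj
  rcases Nat.eq_zero_or_pos i with rfl | hi
  · rcases Nat.lt_or_ge j (N + 1) with hj' | hj'
    · have := h₂ ⟨j - 1, by omega⟩
      rwa [show ((⟨j - 1, by omega⟩ : Fin N) : ℕ) + 1 = j by simp; omega] at this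
    · rwa [show j = N + 1 by omega]
  · rcases Nat.lt_or_ge j (N + 1) with hj' | hj'
    · have := h₄ ⟨i - 1, by omega⟩ ⟨j - 1, by omega⟩ (by simp [Fin.lt_def]; omega)
      rwa [show ((⟨j - 1, by omega⟩ : Fin N) : ℕ) + 1 = j by simp; omega,
        show ((⟨i - 1, by omega⟩ : Fin N) : ℕ) + 1 = i by simp; omega] at this
    · have := h₃ ⟨i - 1, by omega⟩
      rwa [show ((⟨i - 1, by omega⟩ : Fin N) : ℕ) + 1 = i by simp; omega,
        ← show j = N + 1 by omega] at this

theorem tab_ext_chain {N m : ℕ} {y y' : ℕ → ℝ}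
    (h₁ : tab (N + 2) m y 0 (N + 1) = tab (N + 2) m y' 0 (N + 1))
    (h₂ : ∀ t : Fin N, tab (N + 2) m y 0 (t + 1) = tab (N + 2) m y' 0 (t + 1))
    (h₃ : ∀ t : Fin N, tab (N + 2) m y (t + 1) (N + 1) = tab (N + 2) m y' (t + 1) (N + 1))
    (h₄ : ∀ s t : Fin N, s < t →
      tab (N + 2) m y (s + 1) (t + 1) = tab (N + 2) m y' (s + 1) (t + 1)) :
    tab (N + 2) m y = tab (N + 2) m y' := by
  funext i j
  by_cases hc : i < j ∧ j < N + 2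
  · exact forall_pairs (P := fun i j => tab (N + 2) m y i j = tab (N + 2) m y' i j) h₁ h₂ h₃ h₄
      i j hc.1 hc.2
  · rw [tab_of_not hc, tab_of_not hc]

section Chain

variable {N m : ℕ} {δ : ℝ} {a : Fin N → ℕ} {φ : Fin N → ℝ}

theorem ne_natCast_of_lt {x : ℝ} {k : ℕ} (h₁ : (k : ℝ) < x) (h₂ : x < k + 1) (l : ℕ) : x ≠ l := by
  rintro rfl
  have h1 : k < l := by exact_mod_cast h₁
  have h2 : l < k + 1 := by exact_mod_cast h₂
  omega

theorem generic_chain (hδ : 0 < δ) (ha : ∀ t, a t < m) (h₀ : ∀ t, δ < φ t)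
    (h₁ : ∀ t, φ t < 1) (hinj : Function.Injective φ)
    (hz : StrictMono fun t => (a t : ℝ) + φ t) :
    Generic (N + 2) m (chain N m δ fun t => a t + φ t) := by
  refine forall_pairs ?_ ?_ ?_ ?_
  · rw [chain_zero, chain_last]
    refine ⟨by linarith [Nat.cast_nonneg (α := ℝ) m], fun k hk h => ?_⟩
    have : (k : ℝ) ≤ m := by exact_mod_cast hk
    linarith
  · intro t
    have := h₀ t
    have := h₁ t
    rw [chain_zero, chain_succ]
    exact ⟨by linarith [Nat.cast_nonneg (α := ℝ) (a t)], fun k _ =>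
      ne_natCast_of_lt (k := a t) (by linarith) (by linarith) k⟩
  · intro t
    have := h₀ t
    have := h₁ t
    rw [chain_succ, chain_last]
    have hk : ((m - 1 - a t : ℕ) : ℝ) = m - 1 - a t := by
      have := ha t
      rw [Nat.sub_sub, Nat.cast_sub (by omega)]
      push_cast
      ring
    have h1 : ((m - 1 - a t : ℕ) : ℝ) < -(a t + φ t) - -(m + δ) := by rw [hk]; linarith
    exact ⟨(Nat.cast_nonneg _).trans_lt h1, fun k _ =>
      ne_natCast_of_lt (k := m - 1 - a t) h1 (by rw [hk]; linarith) k⟩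
  · intro s t hst
    rw [chain_succ, chain_succ]
    have hlt := hz hst
    simp only at hlt
    refine ⟨by linarith, fun k _ h => ?_⟩
    have e1 : ((k : ℤ) : ℝ) = ((a t - a s : ℤ) : ℝ) + (φ t - φ s) := by
      push_cast
      linarith
    have b1 := h₀ t
    have b2 := h₁ t
    have b3 := h₀ s
    have b4 := h₁ s
    have c1 : ((k : ℤ) - (a t - a s : ℤ) : ℤ) = 0 := by
      have d1 : (-1 : ℝ) < ((k : ℤ) - (a t - a s : ℤ) : ℤ) := by
        push_cast at e1 ⊢; linarith
      have d2 : (((k : ℤ) - (a t - a s : ℤ) : ℤ) : ℝ) < 1 := by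
        push_cast at e1 ⊢; linarith
      have d3 : (-1 : ℤ) < (k : ℤ) - (a t - a s : ℤ) := by exact_mod_cast d1
      have d4 : (k : ℤ) - (a t - a s : ℤ) < 1 := by exact_mod_cast d2
      omega
    have c2 : (k : ℤ) = (a t - a s : ℤ) := by omega
    rw [c2] at e1
    exact hst.ne (hinj (by linarith))

theorem tab_chain_first (hy : Generic (N + 2) m (chain N m δ fun t => a t + φ t))
    (ha : ∀ t, a t < m) (h₀ : ∀ t, 0 < φ t) (h₁ : ∀ t, φ t < 1) (t : Fin N) :
    tab (N + 2) m (chain N m δ fun t => a t + φ t) 0 (t + 1) = a t := by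
  have := h₀ t
  have := h₁ t
  refine hy.tab_eq (by omega) (by omega) (ha t) ?_ ?_ <;> rw [chain_zero, chain_succ] <;> linarith

/-- As `δ < φ t < 1`, the number `m + δ - (a t + φ t)` lies between `m - 1 - a t` and `m - a t`;
this makes complementary entries add up to `m - 1`. -/
theorem tab_chain_last (hy : Generic (N + 2) m (chain N m δ fun t => a t + φ t))
    (hδ : 0 < δ) (ha : ∀ t, a t < m) (h₀ : ∀ t, δ < φ t) (h₁ : ∀ t, φ t < 1) (t : Fin N) :
    tab (N + 2) m (chain N m δ fun t => a t + φ t) (t + 1) (N + 1) = m - 1 - a t := by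
  have := h₀ t
  have := h₁ t
  have hat := ha t
  have hk : ((m - 1 - a t : ℕ) : ℝ) = m - 1 - a t := by
    rw [Nat.sub_sub, Nat.cast_sub (by omega)]
    push_cast
    ring
  refine hy.tab_eq (by omega) (by omega) (by omega) ?_ ?_ <;>
    rw [chain_succ, chain_last, hk] <;> linarith

theorem tab_chain_first_last (hy : Generic (N + 2) m (chain N m δ fun t => a t + φ t))
    (hδ : 0 < δ) : tab (N + 2) m (chain N m δ fun t => a t + φ t) 0 (N + 1) = m := by
  refine le_antisymm (tab_le ..) ((hy.le_tab_iff (by omega) (by omega) le_rfl).2 ?_)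
  rw [chain_zero, chain_last]
  linarith

/-- The fractional parts differ by less than `1`, so an inner entry depends only on the integer
parts and on the order of the fractional parts. -/
theorem lt_tab_chain_iff (hy : Generic (N + 2) m (chain N m δ fun t => a t + φ t))
    (h₀ : ∀ t, 0 < φ t) (h₁ : ∀ t, φ t < 1) {s t : Fin N} (hst : s < t) {k : ℕ} (hk : k ≤ m) :
    k ≤ tab (N + 2) m (chain N m δ fun t => a t + φ t) (s + 1) (t + 1) ↔
      k + a s < a t ∨ k + a s = a t ∧ φ s < φ t := by
  rw [hy.le_tab_iff (by simpa using hst) (by omega) hk, chain_succ, chain_succ]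
  have := cast_lt_add_iff (k := k) (d := a t - a s) (x := φ t - φ s)
    (by linarith [h₀ t, h₁ s]) (by linarith [h₀ s, h₁ t])
  rw [show -((a s : ℝ) + φ s) - -(a t + φ t) = ((a t - a s : ℤ) : ℝ) + (φ t - φ s) by
    push_cast; ring]
  rw [Int.cast_natCast] at this
  rw [this, sub_pos]
  constructor
  · rintro (h | ⟨h, h'⟩)
    · exact Or.inl (by omega)
    · exact Or.inr ⟨by omega, h'⟩
  · rintro (h | ⟨h, h'⟩)
    · exact Or.inl (by omega)
    · exact Or.inr ⟨by omega, h'⟩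

end Chain

/-! ### Tableaux from functions `Fin N → Fin m` -/

/-- Fractional parts `(r + 1) / (N + 1)`, for `r < N`. -/
noncomputable def fracPart {N : ℕ} (r : Fin N) : ℝ := ((r : ℕ) + 1) / (N + 1)

theorem fracPart_strictMono {N : ℕ} : StrictMono (fracPart (N := N)) := by
  intro r s h
  have : ((r : ℕ) : ℝ) < (s : ℕ) := by exact_mod_cast h
  unfold fracPart
  gcongr

/-- The bound is half the smallest possible fractional part and plays the role of `δ` in `chainOf`.
-/
theorem lt_fracPart {N : ℕ} (r : Fin N) : (1 / (2 * (N + 1)) : ℝ) < fracPart r := by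
  have h : (0 : ℝ) < N + 1 := by positivity
  rw [fracPart, div_lt_div_iff₀ (by positivity) h]
  have : (0 : ℝ) ≤ (r : ℕ) := by positivity
  nlinarith

theorem fracPart_lt {N : ℕ} (r : Fin N) : fracPart r < 1 := by
  rw [fracPart, div_lt_one (by positivity)]
  have : ((r : ℕ) : ℝ) < N := by exact_mod_cast r.2
  linarith

/-- The permutation sorting the numbers `f r + (r + 1) / (N + 1)`. -/
noncomputable def sortPerm {N m : ℕ} (f : Fin N → Fin m) : Equiv.Perm (Fin N) :=
  Tuple.sort fun r => ((f r : ℕ) : ℝ) + fracPart r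

theorem injective_add_fracPart {N m : ℕ} (f : Fin N → Fin m) :
    Function.Injective fun r => ((f r : ℕ) : ℝ) + fracPart r := by
  intro r s h
  simp only at h
  apply fracPart_strictMono.injective
  have h0 := (by positivity : (0 : ℝ) < 1 / (2 * (N + 1)))
  have b1 := lt_fracPart r
  have b2 := fracPart_lt r
  have b3 := lt_fracPart s
  have b4 := fracPart_lt s
  have d1 : ((f r : ℕ) : ℝ) < (f s : ℕ) + 1 := by linarith
  have d2 : ((f s : ℕ) : ℝ) < (f r : ℕ) + 1 := by linarith
  have e1 : (f r : ℕ) < f s + 1 := by exact_mod_cast d1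
  have e2 : (f s : ℕ) < f r + 1 := by exact_mod_cast d2
  rw [show (f r : ℕ) = f s by omega] at h
  linarith

theorem strictMono_sortPerm {N m : ℕ} (f : Fin N → Fin m) :
    StrictMono fun t => ((f (sortPerm f t) : ℕ) : ℝ) + fracPart (sortPerm f t) :=
  (Tuple.monotone_sort fun r => ((f r : ℕ) : ℝ) + fracPart r).strictMono_of_injective
    ((injective_add_fracPart f).comp (sortPerm f).injective)

/-- The points attached to a function `f : Fin N → Fin m`. -/
noncomputable def chainOf {N m : ℕ} (f : Fin N → Fin m) : ℕ → ℝ :=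
  chain N m (1 / (2 * (N + 1))) fun t =>
    ((f (sortPerm f t) : ℕ) : ℝ) + fracPart (sortPerm f t)

theorem generic_chainOf {N m : ℕ} (f : Fin N → Fin m) : Generic (N + 2) m (chainOf f) :=
  generic_chain (by positivity) (fun _ => (f _).2) (fun _ => lt_fracPart _)
    (fun _ => fracPart_lt _) (fracPart_strictMono.injective.comp (sortPerm f).injective)
    (strictMono_sortPerm f)

theorem fracPart_pos {N : ℕ} (r : Fin N) : 0 < fracPart r := by
  unfold fracPart; positivity

theorem tab_chainOf_first {N m : ℕ} (f : Fin N → Fin m) (t : Fin N) :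
    tab (N + 2) m (chainOf f) 0 (t + 1) = f (sortPerm f t) :=
  tab_chain_first (generic_chainOf f) (fun _ => (f _).2) (fun _ => fracPart_pos _)
    (fun _ => fracPart_lt _) t

theorem tab_chainOf_last {N m : ℕ} (f : Fin N → Fin m) (t : Fin N) :
    tab (N + 2) m (chainOf f) (t + 1) (N + 1) = m - 1 - f (sortPerm f t) :=
  tab_chain_last (generic_chainOf f) (by positivity) (fun _ => (f _).2) (fun _ => lt_fracPart _)
    (fun _ => fracPart_lt _) t

theorem tab_chainOf_first_last {N m : ℕ} (f : Fin N → Fin m) :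
    tab (N + 2) m (chainOf f) 0 (N + 1) = m :=
  tab_chain_first_last (generic_chainOf f) (by positivity)

theorem le_tab_chainOf_iff {N m : ℕ} (f : Fin N → Fin m) {s t : Fin N} (hst : s < t) {k : ℕ}
    (hk : k ≤ m) : k ≤ tab (N + 2) m (chainOf f) (s + 1) (t + 1) ↔
      k + f (sortPerm f s) < (f (sortPerm f t) : ℕ) ∨
        k + f (sortPerm f s) = (f (sortPerm f t) : ℕ) ∧ sortPerm f s < sortPerm f t := by
  rw [← fracPart_strictMono.lt_iff_lt]
  exact lt_tab_chain_iff (generic_chainOf f) (fun _ => fracPart_pos _) (fun _ => fracPart_lt _)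
    hst hk

/-- A permutation is determined by its inversions: `τ ∘ σ⁻¹` is an order automorphism of `Fin N`,
hence the identity. -/
theorem perm_eq_of_lt_iff {N : ℕ} {σ τ : Equiv.Perm (Fin N)}
    (h : ∀ s t, s < t → (σ s < σ t ↔ τ s < τ t)) : σ = τ := by
  have h' : ∀ s t, σ s < σ t ↔ τ s < τ t := by
    intro s t
    rcases lt_trichotomy s t with hst | rfl | hst
    · exact h s t hst
    · simp
    · rw [← not_le, ← not_le, not_iff_not, le_iff_lt_or_eq, le_iff_lt_or_eq, h t s hst,
        σ.injective.eq_iff, τ.injective.eq_iff]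
  let e : Fin N ≃o Fin N :=
    { σ.symm.trans τ with
      map_rel_iff' := by
        intro x y
        have := h' (σ.symm y) (σ.symm x)
        simp only [Equiv.apply_symm_apply] at this
        simp only [Equiv.trans_apply]
        rw [← not_lt, ← this, not_lt] }
  ext t
  have : e (σ t) = σ t := by rw [Subsingleton.elim e (OrderIso.refl _)]; rfl
  rw [← this]
  simp [e]

/-- The first row gives `f ∘ sortPerm f`, and the inner entries give the inversions of `sortPerm f`.
-/
theorem tab_chainOf_injective {N m : ℕ} :
    Function.Injective fun f : Fin N → Fin m => tab (N + 2) m (chainOf f) := by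
  intro f g h
  simp only at h
  have ha : ∀ t, (f (sortPerm f t) : ℕ) = g (sortPerm g t) := fun t => by
    rw [← tab_chainOf_first, h, tab_chainOf_first]
  have hσ : sortPerm f = sortPerm g := by
    refine perm_eq_of_lt_iff fun s t hst => ?_
    have hle : (f (sortPerm f s) : ℕ) ≤ f (sortPerm f t) := by
      have h1 := strictMono_sortPerm f hst
      simp only at h1
      have h2 := fracPart_pos (sortPerm f s)
      have h3 := fracPart_lt (sortPerm f t)
      have h4 : ((f (sortPerm f s) : ℕ) : ℝ) < (f (sortPerm f t) : ℕ) + 1 := by linarith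
      have h5 : (f (sortPerm f s) : ℕ) < (f (sortPerm f t) : ℕ) + 1 := by exact_mod_cast h4
      omega
    -- At this `k`, the difference of the integer parts, the inner entry detects which fractional
    -- part is larger.
    have hk : (f (sortPerm f t) : ℕ) - f (sortPerm f s) ≤ m := by
      have := (f (sortPerm f t)).2
      omega
    have h1 := le_tab_chainOf_iff f hst hk
    have h2 := le_tab_chainOf_iff g hst hk
    rw [h, h2, ← ha, ← ha, Nat.sub_add_cancel hle] at h1
    simpa using h1.symm
  funext r
  have := ha ((sortPerm f).symm r)
  rw [← hσ, Equiv.apply_symm_apply] at this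
  exact Fin.ext this

theorem exists_chainOf {N m : ℕ} {E : ℕ → ℕ → ℕ} (hE : E ∈ sepTab (N + 2) m 0 (N + 1)) :
    ∃ f : Fin N → Fin m, tab (N + 2) m (chainOf f) = E := by
  obtain ⟨⟨y, hy, rfl⟩, hs⟩ := hE
  have hs2 : ∀ t : Fin N, tab (N + 2) m y 0 (t + 1) + tab (N + 2) m y (t + 1) (N + 1) + 1 = m :=
    fun t => hs.2 (t + 1) (by omega) (by omega)
  set a : Fin N → ℕ := fun t => tab (N + 2) m y 0 (t + 1) with ha
  set φ : Fin N → ℝ := fun t => y 0 - y (t + 1) - a t with hφ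
  have ham : ∀ t, a t < m := fun t => by have := hs2 t; simp only [ha]; omega
  have h0 : ∀ t, 0 < φ t := fun t => by
    have := hy.tab_lt (i := 0) (j := t + 1) (by omega) (by omega)
    simp only [hφ, ha]; linarith
  have h1 : ∀ t, φ t < 1 := fun t => by
    have := hy.lt_tab_add_one (i := 0) (j := t + 1) (by omega) (by omega) (ham t)
    simp only [hφ, ha]; linarith
  have hyφ : ∀ s t : Fin N, y (s + 1) - y (t + 1) = ((a t - a s : ℤ) : ℝ) + (φ t - φ s) := by
    intro s t
    simp only [hφ]; push_cast; ring
  have hmono : ∀ s t : Fin N, s < t → a s ≤ a t := by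
    intro s t hst
    exact hy.tab_mono le_rfl (by simpa using hst.le) (by omega) (by omega)
  have hinj : Function.Injective φ := by
    have : ∀ s t, s < t → φ s ≠ φ t := by
      intro s t hst h
      refine (hy (s + 1) (t + 1) (by simpa using hst) (by omega)).2 (a t - a s)
        (by have := ham t; omega) ?_
      rw [hyφ, h, Nat.cast_sub (hmono s t hst)]
      push_cast
      ring
    intro s t h
    rcases lt_trichotomy s t with hst | hst | hst
    · exact absurd h (this s t hst)
    · exact hst
    · exact absurd h.symm (this t s hst)
  set τ := Tuple.sort φ
  have hτm : StrictMono (φ ∘ τ) :=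
    (Tuple.monotone_sort φ).strictMono_of_injective (hinj.comp τ.injective)
  have hlt : ∀ s t, τ.symm s < τ.symm t ↔ φ s < φ t := by
    intro s t
    rw [← hτm.lt_iff_lt]
    simp
  -- `f r` is the integer part of the point whose fractional part has rank `r`.
  set f : Fin N → Fin m := fun r => ⟨a (τ r), ham _⟩ with hf
  -- The order of the points is kept when each fractional part is replaced by the standard one of
  -- the same rank, so `τ.symm` sorts the new numbers.
  have hsort : sortPerm f = τ.symm := by
    have hm : StrictMono ((fun r => ((f r : ℕ) : ℝ) + fracPart r) ∘ τ.symm) := by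
      intro s t hst
      simp only [Function.comp_apply, hf, Equiv.apply_symm_apply]
      rcases (hmono s t hst).eq_or_lt with h | h
      · have hy1 := hy.pos (i := s + 1) (j := t + 1) (by simpa using hst) (by omega)
        rw [hyφ, h] at hy1
        push_cast at hy1
        have := fracPart_strictMono ((hlt s t).2 (by linarith))
        rw [h]
        linarith
      · have h' : (a s : ℝ) + 1 ≤ a t := by exact_mod_cast h
        linarith [fracPart_lt (τ.symm s), fracPart_pos (τ.symm t)]
    exact (Tuple.eq_sort_iff.2
      ⟨hm.monotone, fun i j hij h => absurd h (hm hij).ne⟩).symm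
  have hfa : ∀ t, (f (sortPerm f t) : ℕ) = a t := fun t => by rw [hsort]; simp [hf]
  refine ⟨f, tab_ext_chain ?_ ?_ ?_ ?_⟩
  · rw [tab_chainOf_first_last, hs.1]
  · intro t
    rw [tab_chainOf_first, hfa]
  · intro t
    have := hs2 t
    rw [tab_chainOf_last, hfa]
    simp only [ha]
    omega
  · intro s t hst
    have key : ∀ k ≤ m, k ≤ tab (N + 2) m (chainOf f) (s + 1) (t + 1) ↔
        k ≤ tab (N + 2) m y (s + 1) (t + 1) := by
      intro k hk
      rw [le_tab_chainOf_iff f hst hk, hfa, hfa, hsort, hlt,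
        hy.le_tab_iff (by simpa using hst) (by omega) hk, hyφ]
      have := cast_lt_add_iff (k := k) (d := a t - a s) (x := φ t - φ s)
        (by linarith [h0 t, h1 s]) (by linarith [h0 s, h1 t])
      rw [Int.cast_natCast] at this
      rw [this, sub_pos]
      constructor
      · rintro (h | ⟨h, h'⟩)
        · exact Or.inl (by omega)
        · exact Or.inr ⟨by omega, h'⟩
      · rintro (h | ⟨h, h'⟩)
        · exact Or.inl (by omega)
        · exact Or.inr ⟨by omega, h'⟩
    exact le_antisymm ((key _ (tab_le ..)).1 le_rfl) ((key _ (tab_le ..)).2 le_rfl)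

theorem chainOf_mem {N m : ℕ} (f : Fin N → Fin m) :
    tab (N + 2) m (chainOf f) ∈ sepTab (N + 2) m 0 (N + 1) := by
  refine ⟨⟨_, generic_chainOf f, rfl⟩, tab_chainOf_first_last f, fun t h1 h2 => ?_⟩
  obtain ⟨t, rfl⟩ : ∃ s : Fin N, t = s + 1 := ⟨⟨t - 1, by omega⟩, by simp; omega⟩
  rw [tab_chainOf_first, tab_chainOf_last]
  have := (f (sortPerm f t)).2
  omega

/-- Each value `f r` contributes `f r` to the first row and `m - 1 - f r` to the last column,
independently of the others, so the sum over `f` factors. -/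
theorem tabGenFun_zero (N m : ℕ) :
    tabGenFun (N + 2) m 0 (N + 1) = p ^ m * q ^ m * polyInt m p q ^ N := by
  have h1 : polyInt m p q ^ N =
      ∑ f : Fin N → Fin m, ∏ r, p ^ (m - 1 - (f r : ℕ)) * q ^ (f r : ℕ) := by
    have : polyInt m p q = ∑ j : Fin m, p ^ (m - 1 - (j : ℕ)) * q ^ (j : ℕ) := by
      rw [polyInt, ← Finset.sum_range_reflect, Finset.sum_range]
      refine Finset.sum_congr rfl fun j _ => ?_
      rw [show m - 1 - (m - 1 - (j : ℕ)) = j by have := j.2; omega]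
    have h2 := Finset.prod_univ_sum (fun _ : Fin N => (Finset.univ : Finset (Fin m)))
      (fun _ j => p ^ (m - 1 - (j : ℕ)) * q ^ (j : ℕ))
    rw [Fintype.piFinset_univ] at h2
    rw [← h2, ← this, Finset.prod_const, Finset.card_univ, Fintype.card_fin]
  rw [h1, Finset.mul_sum, tabGenFun]
  symm
  refine Finset.sum_bij (fun f _ => tab (N + 2) m (chainOf f)) ?_ ?_ ?_ ?_
  · intro f _
    rw [Set.Finite.mem_toFinset]
    exact chainOf_mem f
  · intro f _ g _ h
    exact tab_chainOf_injective h
  · intro E hE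
    obtain ⟨f, hf⟩ := exists_chainOf ((Set.Finite.mem_toFinset _).1 hE)
    exact ⟨f, Finset.mem_univ _, hf⟩
  · intro f _
    have hc : colSum (N + 2) (tab (N + 2) m (chainOf f)) = m + ∑ r, (m - 1 - (f r : ℕ)) := by
      rw [colSum, show N + 2 - 1 = N + 1 by omega, Finset.sum_range_succ', Finset.sum_range,
        tab_chainOf_first_last, add_comm, ← Equiv.sum_comp (sortPerm f) fun r => m - 1 - (f r : ℕ)]
      simp only [tab_chainOf_last]
    have hr : rowSum (N + 2) (tab (N + 2) m (chainOf f)) = m + ∑ r, (f r : ℕ) := by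
      rw [rowSum, show N + 2 - 1 = N + 1 by omega, Finset.sum_range_succ, Finset.sum_range,
        tab_chainOf_first_last, add_comm, ← Equiv.sum_comp (sortPerm f) fun r => (f r : ℕ)]
      simp only [tab_chainOf_first]
    rw [hc, hr, Finset.prod_mul_distrib, Finset.prod_pow_eq_pow_sum, Finset.prod_pow_eq_pow_sum,
      pow_add, pow_add]
    ring

/-! ### Reversing the order of the points -/

/-- The tableau of the reversed points. -/
def flip (n : ℕ) (E : ℕ → ℕ → ℕ) : ℕ → ℕ → ℕ :=
  fun i j => if i < j ∧ j < n then E (n - 1 - j) (n - 1 - i) else 0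

theorem flip_tab (n m : ℕ) (y : ℕ → ℝ) :
    flip n (tab n m y) = tab n m fun i => -y (n - 1 - i) := by
  funext i j
  unfold flip
  by_cases hc : i < j ∧ j < n
  · rw [if_pos hc, tab, tab, if_pos (by omega), if_pos hc]
    congr 2
    ring
  · rw [if_neg hc, tab_of_not hc]

theorem flip_flip_tab (n m : ℕ) (y : ℕ → ℝ) : flip n (flip n (tab n m y)) = tab n m y := by
  rw [flip_tab, flip_tab]
  refine tab_congr fun i hi => ?_
  rw [neg_neg, show n - 1 - (n - 1 - i) = i by omega]

theorem Generic.reverse {n m : ℕ} {y : ℕ → ℝ} (hy : Generic n m y) :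
    Generic n m fun i => -y (n - 1 - i) := by
  intro i j hij hj
  have := hy (n - 1 - j) (n - 1 - i) (by omega) (by omega)
  rwa [show -y (n - 1 - i) - -y (n - 1 - j) = y (n - 1 - j) - y (n - 1 - i) by ring]

theorem flip_mem {n m u w : ℕ} (huw : u < w) (hw : w < n) {E : ℕ → ℕ → ℕ}
    (hE : E ∈ sepTab n m u w) : flip n E ∈ sepTab n m (n - 1 - w) (n - 1 - u) := by
  obtain ⟨⟨y, hy, rfl⟩, h1, h2⟩ := hE
  refine ⟨⟨_, hy.reverse, flip_tab n m y⟩, ?_, fun t ht ht' => ?_⟩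
  · rw [flip, if_pos (by omega), show n - 1 - (n - 1 - w) = w by omega,
      show n - 1 - (n - 1 - u) = u by omega, h1]
  · rw [flip, if_pos (by omega), flip, if_pos (by omega), show n - 1 - (n - 1 - w) = w by omega,
      show n - 1 - (n - 1 - u) = u by omega, add_comm (tab n m y _ _)]
    exact h2 _ (by omega) (by omega)

theorem colSum_flip (n : ℕ) (E : ℕ → ℕ → ℕ) : colSum n (flip n E) = rowSum n E := by
  unfold colSum rowSum
  rw [← Finset.sum_range_reflect]
  refine Finset.sum_congr rfl fun i hi => ?_
  rw [Finset.mem_range] at hi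
  rw [flip, if_pos (by omega), Nat.sub_self]
  congr 1
  omega

theorem rowSum_flip (n : ℕ) (E : ℕ → ℕ → ℕ) : rowSum n (flip n E) = colSum n E := by
  unfold colSum rowSum
  rw [← Finset.sum_range_reflect]
  refine Finset.sum_congr rfl fun i hi => ?_
  rw [Finset.mem_range] at hi
  rw [flip, if_pos (by omega), Nat.sub_zero]
  congr 1
  omega

theorem rho_sum {ι : Type*} (s : Finset ι) (f : ι → Poly) :
    rho (∑ i ∈ s, f i) = ∑ i ∈ s, rho (f i) := by
  simp [rho]

theorem rho_pow_mul_pow (a b : ℕ) : rho (p ^ a * q ^ b) = p ^ b * q ^ a := by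
  simp [rho, p, q, mul_comm]

/-- The reversal `y i ↦ -y (n - 1 - i)` is an involution that exchanges the first row with the last
column. -/
theorem tabGenFun_eq_rho {n m u w : ℕ} (huw : u < w) (hw : w < n) :
    tabGenFun n m u w = rho (tabGenFun n m (n - 1 - w) (n - 1 - u)) := by
  rw [tabGenFun, tabGenFun, rho_sum]
  refine Finset.sum_bij' (fun E _ => flip n E) (fun E _ => flip n E) ?_ ?_ ?_ ?_ ?_
  · intro E hE
    rw [Set.Finite.mem_toFinset] at hE ⊢
    exact flip_mem huw hw hE
  · intro E hE
    rw [Set.Finite.mem_toFinset] at hE ⊢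
    have := flip_mem (by omega) (by omega) hE
    rwa [show n - 1 - (n - 1 - w) = w by omega, show n - 1 - (n - 1 - u) = u by omega] at this
  · intro E hE
    obtain ⟨⟨y, hy, rfl⟩, -⟩ := (Set.Finite.mem_toFinset _).1 hE
    exact flip_flip_tab n m y
  · intro E hE
    obtain ⟨⟨y, hy, rfl⟩, -⟩ := (Set.Finite.mem_toFinset _).1 hE
    exact flip_flip_tab n m y
  · intro E _
    rw [rho_pow_mul_pow, colSum_flip, rowSum_flip]

/-! ### The full recursion for tableaux -/

theorem tabGenFun_eq_phiRange {n m u w : ℕ} (huw : u < w) (hw : w + 1 ≤ n) :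
    tabGenFun n m u w = phiRange m (w + 2) n (tabGenFun (w + 1) m u w) := by
  induction n, hw using Nat.le_induction with
  | base => simp [phiRange]
  | succ k hk ih =>
    rw [tabGenFun_succ huw hk, ih, phiRange, phiRange, List.Ico.succ_top (n := w + 2) (m := k + 1) (by omega),
      List.foldl_append]
    rfl

theorem tabGenFun_eq_recursionRHS {n m u v : ℕ} (hu : 1 ≤ u) (huv : u ≤ v) (hv : v < n) :
    tabGenFun n m (u - 1) v = recursionRHS n m u v := by
  rw [tabGenFun_eq_phiRange (by omega) hv, tabGenFun_eq_rho (by omega) (by omega),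
    show v + 1 - 1 - v = 0 by omega, show v + 1 - 1 - (u - 1) = v - u + 1 by omega,
    tabGenFun_eq_phiRange (n := v + 1) (u := 0) (by omega) (by omega), tabGenFun_zero]
  rfl

/-! ### Realizing tableaux -/

/-- Shi's inequalities for a tableau with entries bounded by `m`. -/
def IsShi (n m : ℕ) (E : ℕ → ℕ → ℕ) : Prop :=
  ∀ i j k, i < j → j < k → k < n →
    (E i k < m → E i j + E j k ≤ E i k) ∧ E i k ≤ E i j + E j k + 1

/-- The last point must lie in an intersection of open intervals or half-lines; Shi's inequalities
say that each lower bound is below each upper bound, which suffices on the line. -/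
theorem IsShi.exists_realization {n m : ℕ} {E : ℕ → ℕ → ℕ} (hE : IsShi n m E) :
    ∃ y : ℕ → ℝ, ∀ i j, i < j → j < n →
      (E i j : ℝ) < y i - y j ∧ (E i j < m → y i - y j < E i j + 1) := by
  induction n with
  | zero => exact ⟨0, fun i j _ hj => absurd hj (Nat.not_lt_zero j)⟩
  | succ n ih =>
    obtain ⟨y, hy⟩ := ih fun i j k hij hjk hk => hE i j k hij hjk (hk.trans n.lt_succ_self)
    have key : ∀ a ∈ ((Finset.range n).filter fun i => E i n < m).image
        (fun i => y i - E i n - 1), ∀ b ∈ (Finset.range n).image fun i => y i - E i n, a < b := by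
      intro a ha b hb
      obtain ⟨j, hj, rfl⟩ := Finset.mem_image.1 ha
      obtain ⟨i, hi, rfl⟩ := Finset.mem_image.1 hb
      rw [Finset.mem_filter, Finset.mem_range] at hj
      rw [Finset.mem_range] at hi
      rcases lt_trichotomy i j with hij | rfl | hij
      · have h1 := (hy i j hij hj.1).1
        have h2 := (hE i j n hij hj.1 n.lt_succ_self).2
        have h3 : (E i n : ℝ) ≤ E i j + E j n + 1 := by exact_mod_cast h2
        linarith
      · linarith
      · have h2 := (hE j i n hij hi n.lt_succ_self).1 hj.2
        have h1 := (hy j i hij hi).2 (by omega)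
        have h3 : (E j i : ℝ) + E i n ≤ E j n := by exact_mod_cast h2
        linarith
    obtain ⟨t, ht1, ht2⟩ := Order.exists_between_finsets _ _ key
    refine ⟨Function.update y n t, fun i j hij hj => ?_⟩
    rw [Function.update_of_ne (by omega : i ≠ n)]
    rcases Nat.lt_or_ge j n with hjn | hjn
    · rw [Function.update_of_ne (by omega)]
      exact hy i j hij hjn
    · obtain rfl : j = n := by omega
      rw [Function.update_self]
      have hi := Finset.mem_range.2 hij
      constructor
      · have := ht2 _ (Finset.mem_image_of_mem _ hi)
        linarith
      · intro h
        have := ht1 _ (Finset.mem_image_of_mem _ (Finset.mem_filter.2 ⟨hi, h⟩))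
        linarith

theorem generic_of_realization {n m : ℕ} {E : ℕ → ℕ → ℕ} (hE : ∀ i j, E i j ≤ m) {y : ℕ → ℝ}
    (h : ∀ i j, i < j → j < n → (E i j : ℝ) < y i - y j ∧ (E i j < m → y i - y j < E i j + 1)) :
    Generic n m y := by
  intro i j hij hj
  obtain ⟨h1, h2⟩ := h i j hij hj
  refine ⟨(Nat.cast_nonneg _).trans_lt h1, fun k hk => ?_⟩
  rcases (hE i j).eq_or_lt with h3 | h3
  · rintro h4
    have : (k : ℝ) ≤ E i j := by rw [h3]; exact_mod_cast hk
    linarith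
  · exact ne_natCast_of_lt h1 (h2 h3) k

theorem tab_of_realization {n m : ℕ} {E : ℕ → ℕ → ℕ} (hE : ∀ i j, E i j ≤ m) {y : ℕ → ℝ}
    (h : ∀ i j, i < j → j < n → (E i j : ℝ) < y i - y j ∧ (E i j < m → y i - y j < E i j + 1))
    {i j : ℕ} (hij : i < j) (hj : j < n) : tab n m y i j = E i j := by
  have hy := generic_of_realization hE h
  obtain ⟨h1, h2⟩ := h i j hij hj
  rcases (hE i j).eq_or_lt with h3 | h3
  · refine le_antisymm ((tab_le ..).trans h3.ge) ((hy.le_tab_iff hij hj (hE i j)).2 h1)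
  · exact hy.tab_eq hij hj h3 h1 (h2 h3)

theorem Generic.isShi {n m : ℕ} {y : ℕ → ℝ} (hy : Generic n m y) : IsShi n m (tab n m y) := by
  intro i j k hij hjk hk
  have hj := hjk.trans hk
  have h1 := hy.tab_lt hij hj
  have h2 := hy.tab_lt hjk hk
  have h3 := hy.tab_lt (hij.trans hjk) hk
  constructor
  · intro h
    have h4 := hy.lt_tab_add_one (hij.trans hjk) hk h
    have h5 : ((tab n m y i j + tab n m y j k : ℕ) : ℝ) < (tab n m y i k + 1 : ℕ) := by
      push_cast
      linarith
    have := Nat.cast_lt.1 h5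
    omega
  · have h0 := tab_le n m y i k
    rcases (tab_le n m y i j).eq_or_lt with h | h
    · omega
    rcases (tab_le n m y j k).eq_or_lt with h' | h'
    · omega
    have h4 := hy.lt_tab_add_one hij hj h
    have h5 := hy.lt_tab_add_one hjk hk h'
    have h6 : ((tab n m y i k : ℕ) : ℝ) < (tab n m y i j + tab n m y j k + 2 : ℕ) := by
      push_cast
      linarith
    have := Nat.cast_lt.1 h6
    omega

/-- Shi's inequalities survive lowering the entry: where it is the long entry, the two parts add up
to exactly `m - 1`; where it is a part, the long entry was already `m`, and `m ≤ (m - 1) + 1`. -/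
theorem exists_generic_neighbour {n m u w : ℕ} {y : ℕ → ℝ} (hy : Generic n m y) (huw : u < w)
    (hw : w < n) (hm : 1 ≤ m) (h : SepCond m u w (tab n m y)) :
    ∃ y', Generic n m y' ∧ tab n m y' u w = m - 1 ∧
      ∀ i j, (i, j) ≠ (u, w) → tab n m y' i j = tab n m y i j := by
  set E : ℕ → ℕ → ℕ := fun i j => if i = u ∧ j = w then m - 1 else tab n m y i j with hE
  have hle : ∀ i j, E i j ≤ m := by
    intro i j
    simp only [hE]
    split_ifs
    · omega
    · exact tab_le ..
  have hS : IsShi n m E := by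
    intro i j k hij hjk hk
    have h0 := hy.isShi i j k hij hjk hk
    have h1 := tab_le n m y i k
    have h2 := h.1
    have h3 := h.2 j
    simp only [hE]
    by_cases c1 : i = u ∧ k = w
    · obtain ⟨rfl, rfl⟩ := c1
      rw [if_pos ⟨rfl, rfl⟩, if_neg (by omega), if_neg (by omega)]
      have := h3 hij hjk
      omega
    · rw [if_neg c1]
      by_cases c2 : i = u ∧ j = w
      · obtain ⟨rfl, rfl⟩ := c2
        rw [if_pos ⟨rfl, rfl⟩, if_neg (by omega)]
        omega
      · rw [if_neg c2]
        by_cases c3 : j = u ∧ k = w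
        · obtain ⟨rfl, rfl⟩ := c3
          rw [if_pos ⟨rfl, rfl⟩]
          omega
        · rw [if_neg c3]
          exact h0
  obtain ⟨y', hy'⟩ := hS.exists_realization
  refine ⟨y', generic_of_realization hle hy', ?_, fun i j hne => ?_⟩
  · rw [tab_of_realization hle hy' huw hw]
    simp [hE]
  · by_cases hc : i < j ∧ j < n
    · rw [tab_of_realization hle hy' hc.1 hc.2]
      simp only [hE]
      rw [if_neg fun h => hne (Prod.ext h.1 h.2)]
    · rw [tab_of_not hc, tab_of_not hc]

/-! ### Points of `V` and regions -/

/-- The coordinates of a point of `V n`, counted from `0`. -/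
noncomputable def pt {n : ℕ} (x : V n) (i : ℕ) : ℝ :=
  if h : i < n then (x : EuclideanSpace ℝ (Fin n)) ⟨i, h⟩ else 0

theorem inner_eps {n i : ℕ} (x : V n) :
    inner ℝ (x : EuclideanSpace ℝ (Fin n)) (eps n (i + 1)) = pt x i := by
  rw [PiLp.inner_apply]
  simp only [eps, pt, add_left_inj]
  by_cases h : i < n
  · rw [dif_pos h, Finset.sum_eq_single ⟨i, h⟩]
    · simp
    · intro b _ hb
      rw [if_neg fun h' => hb (Fin.ext h')]
      simp
    · simp
  · rw [dif_neg h]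
    refine Finset.sum_eq_zero fun b _ => ?_
    rw [if_neg (by omega)]
    simp

theorem inner_root {n i j : ℕ} (x : V n) :
    inner ℝ (x : EuclideanSpace ℝ (Fin n)) (root n (i + 1) j) = pt x i - pt x j := by
  rw [root, inner_sub_right, inner_eps, inner_eps]

theorem pt_add {n : ℕ} (x y : V n) (i : ℕ) : pt (x + y) i = pt x i + pt y i := by
  unfold pt; split_ifs <;> simp

theorem pt_smul {n : ℕ} (c : ℝ) (x : V n) (i : ℕ) : pt (c • x) i = c * pt x i := by
  unfold pt; split_ifs <;> simp

theorem pt_sub {n : ℕ} (x y : V n) (i : ℕ) : pt (x - y) i = pt x i - pt y i := by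
  unfold pt; split_ifs <;> simp

theorem continuous_pt {n : ℕ} (i : ℕ) : Continuous fun x : V n => pt x i := by
  unfold pt
  split_ifs
  · fun_prop
  · exact continuous_const

theorem mem_hyp_root {n i j : ℕ} {k : ℤ} {x : V n} :
    x ∈ hyp (root n (i + 1) j) k ↔ pt x i - pt x j = k := by
  rw [← inner_root]; rfl

theorem mem_halfPos_root {n i j : ℕ} {k : ℤ} {x : V n} :
    x ∈ halfPos (root n (i + 1) j) k ↔ (k : ℝ) ≤ pt x i - pt x j := by
  rw [← inner_root]; rfl

theorem mem_halfNeg_root {n i j : ℕ} {k : ℤ} {x : V n} :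
    x ∈ halfNeg (root n (i + 1) j) k ↔ pt x i - pt x j ≤ k := by
  rw [← inner_root]; rfl

/-- Every tuple of reals is, up to a translation, the coordinate tuple of a point of `V n`. -/
theorem exists_pt_sub_eq {n : ℕ} (y : ℕ → ℝ) :
    ∃ x : V n, ∀ i < n, ∀ j < n, pt x i - pt x j = y i - y j := by
  set c : ℝ := (∑ i : Fin n, y i) / n with hc
  refine ⟨⟨WithLp.toLp 2 fun i : Fin n => y i - c, ?_⟩, fun i hi j hj => ?_⟩
  · change ∑ i : Fin n, (y i - c) = 0
    rw [Finset.sum_sub_distrib]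
    rcases n.eq_zero_or_pos with rfl | hn
    · simp
    · have : (n : ℝ) ≠ 0 := by positivity
      simp only [Finset.sum_const, Finset.card_univ, Fintype.card_fin, nsmul_eq_mul, hc]
      field_simp
      ring
  · simp [pt, hi, hj]

theorem Generic.congr_sub {n m : ℕ} {y y' : ℕ → ℝ} (hy : Generic n m y)
    (h : ∀ i < n, ∀ j < n, y' i - y' j = y i - y j) : Generic n m y' := by
  intro i j hij hj
  rw [h i (hij.trans hj) j hj]
  exact hy i j hij hj

theorem tab_congr_sub {n m : ℕ} {y y' : ℕ → ℝ}
    (h : ∀ i < n, ∀ j < n, y' i - y' j = y i - y j) : tab n m y' = tab n m y := by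
  funext i j
  unfold tab
  split_ifs with hc
  · rw [h i (hc.1.trans hc.2) j hc.2]
  · rfl

/-- The set of points of `V n` with a given tableau. -/
def cell (n m : ℕ) (E : ℕ → ℕ → ℕ) : Set (V n) :=
  {x | Generic n m (pt x) ∧ tab n m (pt x) = E}

theorem exists_mem_cell {n m : ℕ} {y : ℕ → ℝ} (hy : Generic n m y) :
    ∃ x, x ∈ cell n m (tab n m y) := by
  obtain ⟨x, hx⟩ := exists_pt_sub_eq (n := n) y
  exact ⟨x, hy.congr_sub hx, tab_congr_sub hx⟩

theorem convex_cell (n m : ℕ) (E : ℕ → ℕ → ℕ) : Convex ℝ (cell n m E) := by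
  rintro x ⟨hx, hxE⟩ y ⟨hy, hyE⟩ a b ha hb hab
  have hxy := (hx.tab_eq_iff hy).1 (hxE.trans hyE.symm)
  have hd : ∀ i j, pt (a • x + b • y) i - pt (a • x + b • y) j =
      a * (pt x i - pt x j) + b * (pt y i - pt y j) := by
    intro i j
    simp only [pt_add, pt_smul]
    ring
  have hlt : ∀ (c s t : ℝ), c < s → c < t → c < a * s + b * t := fun c s t hs ht =>
    convex_Ioi c hs ht ha hb hab
  have hgt : ∀ (c s t : ℝ), s < c → t < c → a * s + b * t < c := fun c s t hs ht =>
    convex_Iio c hs ht ha hb hab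
  have key : ∀ i j k : ℕ, i < j → j < n → k ≤ m →
      ((k : ℝ) < pt x i - pt x j ∧ (k : ℝ) < pt (a • x + b • y) i - pt (a • x + b • y) j) ∨
      (pt x i - pt x j < k ∧ pt (a • x + b • y) i - pt (a • x + b • y) j < k) := by
    intro i j k hij hj hk
    rw [hd]
    rcases lt_or_gt_of_ne ((hx i j hij hj).2 k hk) with h | h
    · refine Or.inr ⟨h, hgt _ _ _ h (lt_of_le_of_ne ?_ ((hy i j hij hj).2 k hk))⟩
      rw [← not_lt, ← hxy i j k hij hj hk, not_lt]
      exact h.le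
    · exact Or.inl ⟨h, hlt _ _ _ h ((hxy i j k hij hj hk).1 h)⟩
  have hg : Generic n m (pt (a • x + b • y)) := by
    intro i j hij hj
    refine ⟨?_, fun k hk => ?_⟩
    · rw [hd]
      exact hlt _ _ _ (hx.pos hij hj) (hy.pos hij hj)
    · rcases key i j k hij hj hk with h | h
      · exact h.2.ne'
      · exact h.2.ne
  refine ⟨hg, hxE ▸ (hg.tab_eq_iff hx).2 fun i j k hij hj hk => ?_⟩
  rcases key i j k hij hj hk with h | h
  · exact ⟨fun _ => h.1, fun _ => h.2⟩
  · exact ⟨fun h' => absurd h' h.2.not_gt, fun h' => absurd h' h.1.not_gt⟩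

theorem mem_complementSet_iff {n m : ℕ} {x : V n} : x ∈ complementSet n m ↔
    ∀ i j, i < j → j < n → ∀ k : ℤ, -(m : ℤ) < k → k ≤ m → pt x i - pt x j ≠ k := by
  simp only [complementSet, Set.mem_compl_iff, Set.mem_sUnion, not_exists, not_and]
  constructor
  · intro h i j hij hj k hk hk' heq
    refine h (hyp (root n (i + 1) j) k)
      ⟨_, ⟨i + 1, j + 1, by omega, by omega, by omega, rfl⟩, k, hk, hk', rfl⟩ (mem_hyp_root.2 heq)
  · rintro h H ⟨α, ⟨i, j, hi, hij, hj, rfl⟩, k, hk, hk', rfl⟩ hx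
    obtain ⟨i, rfl⟩ : ∃ i', i = i' + 1 := ⟨i - 1, by omega⟩
    obtain ⟨j, rfl⟩ : ∃ j', j = j' + 1 := ⟨j - 1, by omega⟩
    exact h i j (by omega) (by omega) k hk hk' (mem_hyp_root.1 hx)

theorem Generic.mem_complementSet {n m : ℕ} {x : V n} (hx : Generic n m (pt x)) :
    x ∈ complementSet n m := by
  rw [mem_complementSet_iff]
  intro i j hij hj k _ hk h
  have hpos := hx.pos hij hj
  rw [h] at hpos
  have hk0 : 0 < k := by exact_mod_cast hpos
  lift k to ℕ using hk0.le
  exact (hx i j hij hj).2 k (by exact_mod_cast hk) (by simpa using h)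

theorem dominantChamber_antitone {n : ℕ} {x : V n} (hx : x ∈ dominantChamber n) {i j : ℕ}
    (hij : i ≤ j) (hj : j < n) : pt x j ≤ pt x i := by
  induction j, hij using Nat.le_induction with
  | base => rfl
  | succ k hk ih =>
    have h1 := ih (by omega)
    have h2 := mem_halfPos_root.1 (hx (k + 1) (by omega) (by omega))
    push_cast at h2
    linarith

theorem Generic.mem_dominantChamber {n m : ℕ} {x : V n} (hx : Generic n m (pt x)) :
    x ∈ dominantChamber n := by
  intro i hi hi'
  obtain ⟨i, rfl⟩ : ∃ i', i = i' + 1 := ⟨i - 1, by omega⟩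
  rw [mem_halfPos_root]
  have := hx.pos (i := i) (j := i + 1) (by omega) (by omega)
  push_cast
  exact this.le

theorem generic_pt {n m : ℕ} (hm : 1 ≤ m) {x : V n} (hx : x ∈ complementSet n m)
    (hd : x ∈ dominantChamber n) : Generic n m (pt x) := by
  rw [mem_complementSet_iff] at hx
  intro i j hij hj
  -- As `m ≥ 1`, the hyperplanes with `k = 0` belong to the arrangement, so the differences are
  -- nonzero.
  have h0 := hx i j hij hj 0 (by omega) (by omega)
  push_cast at h0
  refine ⟨lt_of_le_of_ne (sub_nonneg.2 (dominantChamber_antitone hd hij.le hj)) h0.symm,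
    fun k hk => ?_⟩
  have := hx i j hij hj k (by omega) (by exact_mod_cast hk)
  rwa [Int.cast_natCast] at this

theorem lt_of_isPreconnected {X : Type*} [TopologicalSpace X] {s : Set X}
    (hs : IsPreconnected s) {f : X → ℝ} (hf : Continuous f) {c : ℝ} (hc : ∀ z ∈ s, f z ≠ c)
    {x y : X} (hx : x ∈ s) (hy : y ∈ s) (h : c < f x) : c < f y := by
  by_contra h'
  obtain ⟨z, hz, hzc⟩ := hs.intermediate_value hy hx hf.continuousOn ⟨not_lt.1 h', h.le⟩
  exact hc z hz hzc

/-- On a connected part of the complement no difference can cross an integer `k ≤ m`, `k ≥ 0`;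
conversely a cell is convex. -/
theorem connectedComponentIn_eq_cell {n m : ℕ} (hm : 1 ≤ m) {x : V n}
    (hx : Generic n m (pt x)) :
    connectedComponentIn (complementSet n m) x = cell n m (tab n m (pt x)) := by
  apply Set.Subset.antisymm
  · intro y hy
    have hsub := connectedComponentIn_subset (complementSet n m) x
    have hxc := mem_connectedComponentIn hx.mem_complementSet
    have hpre := isPreconnected_connectedComponentIn (F := complementSet n m) (x := x)
    have hlt : ∀ i j : ℕ, i < j → j < n → ∀ k : ℕ, k ≤ m →
        ((k : ℝ) < pt x i - pt x j ↔ (k : ℝ) < pt y i - pt y j) := by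
      intro i j hij hj k hk
      have hc : ∀ z ∈ connectedComponentIn (complementSet n m) x, pt z i - pt z j ≠ k := by
        intro z hz
        have := mem_complementSet_iff.1 (hsub hz) i j hij hj k (by omega) (by exact_mod_cast hk)
        rwa [Int.cast_natCast] at this
      have hf : Continuous fun z : V n => pt z i - pt z j := (continuous_pt i).sub (continuous_pt j)
      exact ⟨lt_of_isPreconnected hpre hf hc hxc hy, lt_of_isPreconnected hpre hf hc hy hxc⟩
    have hg : Generic n m (pt y) := by
      refine generic_pt hm (hsub hy) fun i hi hi' => ?_
      obtain ⟨i, rfl⟩ : ∃ i', i = i' + 1 := ⟨i - 1, by omega⟩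
      rw [mem_halfPos_root]
      have := (hlt i (i + 1) (by omega) (by omega) 0 (by omega)).1
        (by simpa using hx.pos (i := i) (j := i + 1) (by omega) (by omega))
      push_cast at this ⊢
      exact this.le
    exact ⟨hg, ((hx.tab_eq_iff hg).2 fun i j k hij hj hk => hlt i j hij hj k hk).symm⟩
  · exact (convex_cell n m _).isPreconnected.subset_connectedComponentIn ⟨hx, rfl⟩
      fun y hy => hy.1.mem_complementSet

theorem mem_dominantRegions_iff {n m : ℕ} (hm : 1 ≤ m) {R : Set (V n)} :
    R ∈ dominantRegions n m ↔ ∃ x : V n, Generic n m (pt x) ∧ R = cell n m (tab n m (pt x)) := by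
  constructor
  · rintro ⟨⟨x, hx, rfl⟩, hR⟩
    have hg := generic_pt hm hx (hR (mem_connectedComponentIn hx))
    exact ⟨x, hg, connectedComponentIn_eq_cell hm hg⟩
  · rintro ⟨x, hx, rfl⟩
    exact ⟨⟨x, hx.mem_complementSet, (connectedComponentIn_eq_cell hm hx).symm⟩,
      fun y hy => hy.1.mem_dominantChamber⟩

/-! ### Separation from the fundamental alcove -/

theorem fundamentalAlcove_le_one {n i j : ℕ} {x : V n} (hx : x ∈ fundamentalAlcove n)
    (hij : i < j) (hj : j < n) : pt x i - pt x j ≤ 1 := by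
  obtain ⟨h1, h2⟩ := interior_subset hx
  have h3 : pt x 0 - pt x (n - 1) ≤ ((1 : ℤ) : ℝ) := mem_halfNeg_root.1 (by simpa using h1)
  have h4 := dominantChamber_antitone h2 (Nat.zero_le i) (hij.trans hj)
  have h5 := dominantChamber_antitone h2 (show j ≤ n - 1 by omega) (by omega)
  push_cast at h3
  linarith

theorem exists_mem_fundamentalAlcove {n : ℕ} (hn : 1 ≤ n) :
    ∃ x ∈ fundamentalAlcove n, ∀ i j, i < j → j < n → pt x i - pt x j < 1 := by
  -- Equally spaced points with gap `1 / (n + 1)` have total spread below `1`.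
  obtain ⟨x, hx⟩ := exists_pt_sub_eq (n := n) fun i => -(i : ℝ) / (n + 1)
  have hn1 : (0 : ℝ) < n + 1 := by positivity
  have hlt : ∀ i j, i < j → j < n → pt x i - pt x j < 1 := by
    intro i j hij hj
    rw [hx i (hij.trans hj) j hj, ← sub_div, div_lt_one hn1]
    have : (j : ℝ) < n := by exact_mod_cast hj
    linarith [Nat.cast_nonneg (α := ℝ) i]
  refine ⟨x, ?_, hlt⟩
  rw [fundamentalAlcove, mem_interior_iff_mem_nhds]
  have hcont : ∀ i j, Continuous fun z : V n => pt z i - pt z j :=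
    fun i j => (continuous_pt i).sub (continuous_pt j)
  refine Filter.inter_mem ?_ ?_
  · have h0 : pt x 0 - pt x (n - 1) < 1 := by
      rcases Nat.eq_zero_or_pos (n - 1) with h | h
      · rw [h]; simp
      · exact hlt 0 (n - 1) h (by omega)
    filter_upwards [(hcont 0 (n - 1)).continuousAt.eventually_lt continuousAt_const h0] with z hz
    have : z ∈ halfNeg (root n (0 + 1) (n - 1)) 1 := mem_halfNeg_root.2 (by simpa using hz.le)
    simpa using this
  · have : ∀ᶠ z in nhds x, ∀ i ∈ Finset.range (n - 1), 0 < pt z i - pt z (i + 1) := by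
      rw [Filter.eventually_all_finset]
      intro i hi
      rw [Finset.mem_range] at hi
      refine continuousAt_const.eventually_lt (hcont i (i + 1)).continuousAt ?_
      rw [hx i (by omega) (i + 1) (by omega), ← sub_div]
      apply div_pos _ hn1
      push_cast
      linarith
    filter_upwards [this] with z hz i hi hi'
    obtain ⟨i, rfl⟩ : ∃ i', i = i' + 1 := ⟨i - 1, by omega⟩
    rw [mem_halfPos_root]
    simpa using (hz i (Finset.mem_range.2 (by omega))).le

/-- The alcove lies on the side `≤ 1 ≤ k` and has a point with all differences below `1`, which
excludes the opposite orientation. -/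
theorem separated_cell_iff {n m : ℕ} {x : V n} (hx : Generic n m (pt x)) {i j k : ℕ}
    (hij : i < j) (hj : j < n) (hk : 1 ≤ k) (hkm : k ≤ m) :
    Separated (root n (i + 1) j) k (cell n m (tab n m (pt x))) (fundamentalAlcove n) ↔
      k ≤ tab n m (pt x) i j := by
  constructor
  · rintro (⟨h, -⟩ | ⟨-, h⟩)
    · have := mem_halfPos_root.1 (h ⟨hx, rfl⟩)
      rw [hx.le_tab_iff hij hj hkm]
      exact lt_of_le_of_ne (by exact_mod_cast this) ((hx i j hij hj).2 k hkm).symm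
    · obtain ⟨z, hz, hlt⟩ := exists_mem_fundamentalAlcove (n := n) (by omega)
      have h1 := mem_halfPos_root.1 (h hz)
      have h2 := hlt i j hij hj
      have h3 : (1 : ℝ) ≤ k := by exact_mod_cast hk
      rw [Int.cast_natCast] at h1
      linarith
  · intro h
    refine Or.inl ⟨fun z hz => ?_, fun z hz => ?_⟩
    · rw [mem_halfPos_root, Int.cast_natCast]
      rw [← hz.2, hz.1.le_tab_iff hij hj hkm] at h
      exact h.le
    · rw [mem_halfNeg_root, Int.cast_natCast]
      exact (fundamentalAlcove_le_one hz hij hj).trans (by exact_mod_cast hk)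

theorem card_filter_le_eq_sum {N m : ℕ} {g : ℕ → ℕ} (hg : ∀ i, g i ≤ m) :
    ((Finset.Icc 1 N ×ˢ Finset.Icc 1 m).filter fun ik => ik.2 ≤ g ik.1).card =
      ∑ i ∈ Finset.range N, g (i + 1) := by
  rw [Finset.card_filter, Finset.sum_product, Finset.range_eq_Ico, Finset.sum_Ico_add' g 0 N 1,
    Nat.zero_add, ← Finset.Ico_add_one_right_eq_Icc]
  refine Finset.sum_congr rfl fun i _ => ?_
  rw [← Finset.card_filter]
  have : (Finset.Icc 1 m).filter (fun k => k ≤ g i) = Finset.Icc 1 (g i) := by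
    ext k
    have := hg i
    simp only [Finset.mem_filter, Finset.mem_Icc]
    omega
  simp [this]

theorem rStat_cell {n m : ℕ} {x : V n} (hx : Generic n m (pt x)) :
    rStat n m (cell n m (tab n m (pt x))) = rowSum n (tab n m (pt x)) := by
  rw [rowSum, ← card_filter_le_eq_sum (m := m) (fun i => tab_le n m (pt x) 0 i),
    ← Set.ncard_coe_finset, rStat]
  congr 1
  ext ⟨j, k⟩
  simp only [Set.mem_ofPred_eq, Finset.coe_filter, Finset.mem_product, Finset.mem_Icc, and_assoc]
  refine and_congr_right fun h1 => and_congr_right fun h2 => and_congr_right fun h3 =>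
    and_congr_right fun h4 => ?_
  exact separated_cell_iff hx (i := 0) (by omega) (by omega) h3 h4

theorem cStat_cell {n m : ℕ} {x : V n} (hx : Generic n m (pt x)) :
    cStat n m (cell n m (tab n m (pt x))) = colSum n (tab n m (pt x)) := by
  have := card_filter_le_eq_sum (N := n - 1) (m := m)
    (fun i => tab_le n m (pt x) (i - 1) (n - 1))
  simp only [Nat.add_sub_cancel] at this
  rw [colSum, ← this, ← Set.ncard_coe_finset, cStat]
  congr 1
  ext ⟨i, k⟩
  simp only [Set.mem_ofPred_eq, Finset.coe_filter, Finset.mem_product, Finset.mem_Icc, and_assoc]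
  refine and_congr_right fun h1 => and_congr_right fun h2 => and_congr_right fun h3 =>
    and_congr_right fun h4 => ?_
  obtain ⟨i, rfl⟩ : ∃ i', i = i' + 1 := ⟨i - 1, by omega⟩
  exact separated_cell_iff hx (by omega) (by omega) h3 h4

/-! ### Walls -/

/-- The hyperplane `hyp α k` as an affine subspace. -/
def hypAffine {n : ℕ} (α : EuclideanSpace ℝ (Fin n)) (k : ℤ) : AffineSubspace ℝ (V n) where
  carrier := hyp α k
  smul_vsub_vadd_mem' := by
    intro c x y z hx hy hz
    simp only [hyp, Set.mem_ofPred_eq] at hx hy hz ⊢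
    simp [inner_add_left, inner_sub_left, inner_smul_left, hx, hy, hz]

/-- A segment from the region to its neighbour crosses only this hyperplane. Near the crossing point
`c` the whole hyperplane lies in the closure of the region, so the face spans it. -/
theorem isWall_cell {n m u w : ℕ} (hm : 1 ≤ m) (huw : u < w) (hw : w < n) {a : V n}
    (ha : Generic n m (pt a)) (h : SepCond m u w (tab n m (pt a))) :
    IsWall n m (cell n m (tab n m (pt a))) (hyp (root n (u + 1) w) m) := by
  refine ⟨⟨_, ⟨u + 1, w + 1, by omega, by omega, by omega, rfl⟩, m, by omega, le_rfl, rfl⟩, ?_⟩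
  set R := cell n m (tab n m (pt a))
  obtain ⟨y', hy', hm', hne⟩ := exists_generic_neighbour ha huw hw hm h
  obtain ⟨b, hb, hbE⟩ := exists_mem_cell hy'
  have hau : (m : ℝ) < pt a u - pt a w := (ha.le_tab_iff huw hw le_rfl).1 h.1.ge
  have hbu : pt b u - pt b w < m := (hb.tab_lt_iff huw hw le_rfl).1 (by rw [hbE, hm']; omega)
  have hab : ∀ i j k : ℕ, i < j → j < n → k ≤ m → (i, j, k) ≠ (u, w, m) →
      ((k : ℝ) < pt a i - pt a j ↔ (k : ℝ) < pt b i - pt b j) := by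
    intro i j k hij hj hk hijk
    rw [← ha.le_tab_iff hij hj hk, ← hb.le_tab_iff hij hj hk, hbE]
    by_cases hc : (i, j) = (u, w)
    · simp only [ne_eq, Prod.mk.injEq] at hc hijk
      obtain ⟨rfl, rfl⟩ := hc
      rw [hm', h.1]
      omega
    · rw [hne i j hc]
  obtain ⟨s, t, hs, ht, hst, hstm⟩ : ∃ s t : ℝ, 0 ≤ s ∧ 0 ≤ t ∧ s + t = 1 ∧
      s * (pt a u - pt a w) + t * (pt b u - pt b w) = m := by
    have hpos : 0 < (pt a u - pt a w) - (pt b u - pt b w) := by linarith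
    refine ⟨(m - (pt b u - pt b w)) / ((pt a u - pt a w) - (pt b u - pt b w)),
      ((pt a u - pt a w) - m) / ((pt a u - pt a w) - (pt b u - pt b w)),
      div_nonneg (by linarith) hpos.le, div_nonneg (by linarith) hpos.le, ?_, ?_⟩ <;>
    · field_simp
      ring
  set c : V n := s • a + t • b with hc
  have hd : ∀ i j, pt c i - pt c j = s * (pt a i - pt a j) + t * (pt b i - pt b j) := by
    intro i j
    simp only [hc, pt_add, pt_smul]
    ring
  have hcu : pt c u - pt c w = m := by rw [hd, hstm]
  have hcont : ∀ i j, Continuous fun z : V n => pt z i - pt z j :=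
    fun i j => (continuous_pt i).sub (continuous_pt j)
  -- The indices of all conditions on the cell, including positivity as `k = 0`, other than the one
  -- being crossed.
  let S : Finset (ℕ × ℕ × ℕ) := ((Finset.range n ×ˢ Finset.range n ×ˢ Finset.range (m + 1)).filter
    fun x => x.1 < x.2.1).erase (u, w, m)
  have hU : ∀ᶠ z in nhds c, ∀ x ∈ S,
      ((x.2.2 : ℝ) < pt a x.1 - pt a x.2.1 ∧ (x.2.2 : ℝ) < pt z x.1 - pt z x.2.1) ∨
      (pt a x.1 - pt a x.2.1 < x.2.2 ∧ pt z x.1 - pt z x.2.1 < x.2.2) := by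
    rw [Filter.eventually_all_finset]
    rintro ⟨i, j, k⟩ hx
    simp only [S, Finset.mem_erase, Finset.mem_filter, Finset.mem_product, Finset.mem_range] at hx
    obtain ⟨hijk, ⟨-, hj, hk⟩, hij⟩ := hx
    have hk := Nat.le_of_lt_succ hk
    have h1 := hab i j k hij hj hk hijk
    simp only
    rcases lt_or_gt_of_ne ((ha i j hij hj).2 k hk) with h2 | h2
    · have h3 : pt b i - pt b j < k := by
        refine lt_of_le_of_ne ?_ ((hb i j hij hj).2 k hk)
        rw [← not_lt, ← h1, not_lt]
        exact h2.le
      have h4 : pt c i - pt c j < k := by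
        rw [hd]
        exact convex_Iio (k : ℝ) h2 h3 hs ht hst
      filter_upwards [(hcont i j).continuousAt.eventually_lt continuousAt_const h4] with z hz
      exact Or.inr ⟨h2, hz⟩
    · have h4 : (k : ℝ) < pt c i - pt c j := by
        rw [hd]
        exact convex_Ioi (k : ℝ) h2 (h1.1 h2) hs ht hst
      filter_upwards [continuousAt_const.eventually_lt (hcont i j).continuousAt h4] with z hz
      exact Or.inl ⟨h2, hz⟩
  have hUR : ∀ᶠ z in nhds c, (m : ℝ) < pt z u - pt z w → z ∈ R := by
    filter_upwards [hU] with z hz hzm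
    have key : ∀ i j k : ℕ, i < j → j < n → k ≤ m →
        ((k : ℝ) < pt a i - pt a j ∧ (k : ℝ) < pt z i - pt z j) ∨
        (pt a i - pt a j < k ∧ pt z i - pt z j < k) := by
      intro i j k hij hj hk
      by_cases hijk : (i, j, k) = (u, w, m)
      · simp only [Prod.mk.injEq] at hijk
        obtain ⟨rfl, rfl, rfl⟩ := hijk
        exact Or.inl ⟨hau, hzm⟩
      · refine hz (i, j, k) ?_
        simp only [S, Finset.mem_erase, Finset.mem_filter, Finset.mem_product, Finset.mem_range]
        exact ⟨hijk, by omega, hij⟩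
    have hg : Generic n m (pt z) := by
      intro i j hij hj
      refine ⟨?_, fun k hk => ?_⟩
      · rcases key i j 0 hij hj (Nat.zero_le m) with h1 | h1
        · simpa using h1.2
        · have := ha.pos hij hj
          have := h1.1
          push_cast at this
          linarith
      · rcases key i j k hij hj hk with h1 | h1
        · exact h1.2.ne'
        · exact h1.2.ne
    refine ⟨hg, (hg.tab_eq_iff ha).2 fun i j k hij hj hk => ?_⟩
    rcases key i j k hij hj hk with h1 | h1
    · exact ⟨fun _ => h1.1, fun _ => h1.2⟩
    · exact ⟨fun h2 => absurd h2 h1.2.not_gt, fun h2 => absurd h2 h1.1.not_gt⟩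
  have hcl : ∀ᶠ z in nhds c, z ∈ hyp (root n (u + 1) w) m → z ∈ closure R := by
    filter_upwards [hUR.eventually_nhds] with z hz hzH
    rw [mem_hyp_root, Int.cast_natCast] at hzH
    have hlim : Filter.Tendsto (fun r : ℝ => z + r • (a - z)) (nhdsWithin 0 (Set.Ioi 0))
        (nhds z) := by
      have : Continuous fun r : ℝ => z + r • (a - z) := by fun_prop
      have h1 := this.tendsto 0
      simp only [zero_smul, add_zero] at h1
      exact h1.mono_left nhdsWithin_le_nhds
    refine mem_closure_of_tendsto hlim ?_
    filter_upwards [hlim.eventually hz, self_mem_nhdsWithin] with r hr hr0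
    refine hr ?_
    have hr0 : 0 < r := hr0
    simp only [pt_add, pt_smul, pt_sub]
    nlinarith
  apply Set.Subset.antisymm
  · have : affineSpan ℝ (closure R ∩ hyp (root n (u + 1) w) m) ≤ hypAffine (root n (u + 1) w) m :=
      affineSpan_le.2 Set.inter_subset_right
    exact this
  · intro z hz
    have hcH : c ∈ hyp (root n (u + 1) w) m := by rw [mem_hyp_root, hcu, Int.cast_natCast]
    -- A far point `z` of the hyperplane lies on the line through `c` and a point of the face near
    -- `c`, at parameter `r⁻¹`.
    have hlim : Filter.Tendsto (fun r : ℝ => AffineMap.lineMap c z r) (nhdsWithin 0 (Set.Ioi 0))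
        (nhds c) := by
      have h1 := (AffineMap.lineMap_continuous (R := ℝ) (p := c) (q := z)).tendsto 0
      rw [AffineMap.lineMap_apply_zero] at h1
      exact h1.mono_left nhdsWithin_le_nhds
    have hpos : ∀ᶠ r in nhdsWithin (0 : ℝ) (Set.Ioi 0), 0 < r := self_mem_nhdsWithin
    obtain ⟨r, hr, hr0⟩ := ((hlim.eventually hcl).and hpos).exists
    have hrH : AffineMap.lineMap c z r ∈ hyp (root n (u + 1) w) m :=
      AffineMap.lineMap_mem (Q := hypAffine (root n (u + 1) w) m) r hcH hz
    have hc1 := subset_affineSpan ℝ (closure R ∩ hyp (root n (u + 1) w) m)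
      ⟨hcl.self_of_nhds hcH, hcH⟩
    have hr1 := subset_affineSpan ℝ (closure R ∩ hyp (root n (u + 1) w) m) ⟨hr hrH, hrH⟩
    have hfin := AffineMap.lineMap_mem r⁻¹ hc1 hr1
    have : AffineMap.lineMap c (AffineMap.lineMap c z r : V n) r⁻¹ = z := by
      rw [AffineMap.lineMap_lineMap_right, inv_mul_cancel₀ hr0.ne', AffineMap.lineMap_apply_one]
    rwa [this] at hfin

/-- Failure means `e + e' ≥ m`, since Shi's inequality gives `e + e' ≥ m - 1`. On the face the
differences are at least `e` and `e'` and add up to `m`, so the first equals `e` and the face lies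
in a second hyperplane. -/
theorem sepCond_of_isWall {n m u w : ℕ} (huw : u < w) (hw : w < n) {a : V n}
    (ha : Generic n m (pt a)) (hE : tab n m (pt a) u w = m)
    (h : IsWall n m (cell n m (tab n m (pt a))) (hyp (root n (u + 1) w) m)) :
    SepCond m u w (tab n m (pt a)) := by
  refine ⟨hE, fun t hut htw => ?_⟩
  have hS := (ha.isShi u t w hut htw hw).2
  by_contra hcon
  set R := cell n m (tab n m (pt a))
  set e := tab n m (pt a) u t
  set e' := tab n m (pt a) t w
  have hle : m ≤ e + e' := by omega
  have hclosed : ∀ i j, i < j → j < n → closure R ⊆ halfPos (root n (i + 1) j)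
      (tab n m (pt a) i j : ℕ) := by
    intro i j hij hj
    have hcl : IsClosed {z : V n | ((tab n m (pt a) i j : ℕ) : ℝ) ≤ pt z i - pt z j} :=
      isClosed_le continuous_const ((continuous_pt i).sub (continuous_pt j))
    intro z hz
    rw [mem_halfPos_root, Int.cast_natCast]
    refine closure_minimal (fun z hz => ?_) hcl hz
    rw [Set.mem_ofPred_eq, ← hz.2]
    exact (hz.1.tab_lt hij hj).le
  have hsub : closure R ∩ hyp (root n (u + 1) w) m ⊆ hypAffine (root n (u + 1) t) (e : ℤ) := by
    rintro z ⟨hz, hzH⟩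
    have h1 := mem_halfPos_root.1 (hclosed u t hut (htw.trans hw) hz)
    have h2 := mem_halfPos_root.1 (hclosed t w htw hw hz)
    have h3 := mem_hyp_root.1 hzH
    change z ∈ hyp (root n (u + 1) t) e
    rw [mem_hyp_root]
    rw [Int.cast_natCast] at h1 h2 h3 ⊢
    have h4 : (m : ℝ) ≤ e + e' := by exact_mod_cast hle
    linarith
  have hspan := affineSpan_le.2 hsub
  -- A point of the wall whose `(u, t)` difference is `e + 1`, outside the second hyperplane.
  obtain ⟨x, hx⟩ := exists_pt_sub_eq (n := n)
    fun i => if i = u then (m : ℝ) else if i = t then m - e - 1 else 0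
  have hxH : x ∈ hyp (root n (u + 1) w) m := by
    rw [mem_hyp_root, hx u (huw.trans hw) w hw, if_pos rfl, if_neg huw.ne', if_neg htw.ne']
    simp
  have hxt : x ∈ hyp (root n (u + 1) t) e := by
    have h2 := h.2
    rw [← h2] at hxH
    exact hspan hxH
  rw [mem_hyp_root, hx u (huw.trans hw) t (htw.trans hw), if_pos rfl, if_neg hut.ne',
    if_pos rfl, Int.cast_natCast] at hxt
  linarith

/-! ### Regions with the separating wall correspond to tableaux -/

theorem bijOn_cell {n m u w : ℕ} (hm : 1 ≤ m) (huw : u < w) (hw : w < n) :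
    Set.BijOn (cell n m) (sepTab n m u w) (sepSet n m (root n (u + 1) w) m) := by
  refine ⟨?_, ?_, ?_⟩
  · rintro E ⟨⟨y, hy, rfl⟩, hs⟩
    obtain ⟨x, hx, hxE⟩ := exists_mem_cell hy
    rw [← hxE] at hs ⊢
    exact ⟨(mem_dominantRegions_iff hm).2 ⟨x, hx, rfl⟩, isWall_cell hm huw hw hx hs,
      (separated_cell_iff hx huw hw hm le_rfl).2 hs.1.ge⟩
  · rintro E ⟨⟨y, hy, rfl⟩, -⟩ E' - h
    obtain ⟨x, hx⟩ := exists_mem_cell hy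
    have hx' := hx
    rw [h] at hx'
    exact hx.2.symm.trans hx'.2
  · rintro R ⟨hR, hwall, hsep⟩
    obtain ⟨x, hx, rfl⟩ := (mem_dominantRegions_iff hm).1 hR
    have hE := (separated_cell_iff hx huw hw hm le_rfl).1 hsep
    exact ⟨_, ⟨⟨_, hx, rfl⟩, sepCond_of_isWall huw hw hx (le_antisymm (tab_le ..) hE) hwall⟩, rfl⟩

theorem genFun_eq_tabGenFun {n m u w : ℕ} (hm : 1 ≤ m) (huw : u < w) (hw : w < n) :
    genFun n m (root n (u + 1) w) = tabGenFun n m u w := by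
  rw [genFun, tabGenFun, ← finsum_mem_eq_finite_toFinset_sum]
  symm
  refine finsum_mem_eq_of_bijOn (cell n m) (bijOn_cell hm huw hw) ?_
  rintro E ⟨⟨y, hy, rfl⟩, -⟩
  obtain ⟨x, hx, hxE⟩ := exists_mem_cell hy
  rw [← hxE, cStat_cell hx, rStat_cell hx]

theorem eval_tabGenFun (n m u w : ℕ) :
    eval (fun _ => 1) (tabGenFun n m u w) = ((sepTab n m u w).ncard : ℤ) := by
  rw [Set.ncard_eq_toFinset_card _ (finite_sepTab n m u w)]
  simp [tabGenFun, p, q]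

end ShiArr

theorem mainTheorem5 (n m u v : ℕ) (hm : 1 ≤ m) (hu : 1 ≤ u) (huv : u ≤ v) (hv : v ≤ n - 1) :
    (ShiArr.sepSet n m (ShiArr.root n u v) (m : ℤ)).Finite ∧
    ShiArr.genFun n m (ShiArr.root n u v) = ShiArr.recursionRHS n m u v ∧
    ((ShiArr.sepSet n m (ShiArr.root n u v) (m : ℤ)).ncard : ℤ) =
      MvPolynomial.eval (fun _ => 1) (ShiArr.recursionRHS n m u v) := by
  obtain ⟨u, rfl⟩ : ∃ u', u = u' + 1 := ⟨u - 1, by omega⟩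
  have hw : v < n := by omega
  have hbij := ShiArr.bijOn_cell hm huv hw
  rw [← ShiArr.tabGenFun_eq_recursionRHS hu huv hw, Nat.add_sub_cancel, ShiArr.eval_tabGenFun,
    ← hbij.image_eq, hbij.injOn.ncard_image]
  exact ⟨(ShiArr.finite_sepTab n m u v).image _, ShiArr.genFun_eq_tabGenFun hm huv hw, rfl⟩
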